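/- Fix $k\in\mathbb N$, a positive definite $k\times k$ matrix $\Sigma$ and $d\in(0,1)$. Let $q_n>0$ with $q_n=o(n)$, and put $c_n=(q_n/n)^{(1+\epsilon_n)/d}$ with $\epsilon_n=1/\log(\log(n/q_n))$. Consider the Exponential-Inverse-Gamma model for $i=1,\dots,n$: given $\boldsymbol\theta_1,\dots,\boldsymbol\theta_n$, the data $\boldsymbol X_i\sim N_k(\boldsymbol\theta_i,\Sigma)$ are independent; given $(\lambda_i^2,\tau_i)_i$, the means $\boldsymbol\theta_i\sim N_k(\boldsymbol 0,\lambda_i^2\tau_i\Sigma)$ are independent; all $\lambda_i^2$ and $\tau_i$ are independent with densities on $(0,\infty)$ $$\pi(\lambda_i^2)\propto \exp(-\lambda_i^2/2),\qquad \pi(\tau_i)\propto \exp\!\big(-c_n/(2\tau_i)\big)\,\tau_i^{-d-1}.$$ Let $\Pi(\cdot\mid\{\boldsymbol X_i\})$ be the posterior distribution of $(\boldsymbol\theta_1,\dots,\boldsymbol\theta_n)$ and let $\widehat{\boldsymbol\theta}_i=E(\boldsymbol\theta_i\mid\boldsymbol X_i)$ be the posterior mean. Let $L_0[q_n]$ be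 the set of $\{\boldsymbol\theta_{0i}\}_{i=1}^n\subset\mathbb R^k$ with at most $q_n$ non-zero vectors $\boldsymbol\theta_{0i}$, and let $E_{\{\boldsymbol\theta_{0i}\}}$ be the expectation when $\boldsymbol X_i\sim N_k(\boldsymbol\theta_{0i},\Sigma)$ independently. Let $\|\cdot\|$ be either the Mahalanobis norm, $\|\boldsymbol v\|^2=\boldsymbol v^{T}\Sigma^{-1}\boldsymbol v$, or the Euclidean norm. Then $$\lim_{n\to\infty}\ \sup_{\{\boldsymbol\theta_{0i}\}\in L_0[q_n]} E_{\{\boldsymbol\theta_{0i}\}}\,\Pi\Big(\sum_{i=1}^n\|\boldsymbol\theta_i-\widehat{\boldsymbol\theta}_i\|^2> q_n\log\frac n{q_n}\ \Big|\ \{\boldsymbol X_i\}\Big)=0,$$ and, for every sequence $\{M_n\}$ with $\lim_{n\to\infty}M_n=\infty$, $$\limsup_{n\to\infty}\ \sup_{\{\boldsymbol\theta_{0i}\}\in L_0[q_n]} E_{\{\boldsymbol\theta_{0i}\}}\,\Pi\Big(\sum_{i=1}^n\|\boldsymbol\theta_i-\boldsymbol\theta_{0i}\|^2> M_n q_n\log\frac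 n{q_n}\ \Big|\ \{\boldsymbol X_i\}\Big)=0.$$ -/

import Mathlib

open Filter Topology MeasureTheory ProbabilityTheory
open scoped ENNReal Matrix

namespace EIG

/-! ### Norms, sparsity and the hyperparameter -/

/-- Squared Mahalanobis norm `xᵀ S⁻¹ x`. -/
noncomputable def mahalanobisSq {k : ℕ} (S : Matrix (Fin k) (Fin k) ℝ)
    (x : EuclideanSpace ℝ (Fin k)) : ℝ :=
  x.ofLp ⬝ᵥ (S⁻¹ *ᵥ x.ofLp)

/-- Squared Euclidean norm. -/
noncomputable def euclideanSq {k : ℕ} (x : EuclideanSpace ℝ (Fin k)) : ℝ := ‖x‖ ^ 2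

/-- Nearly-black arrays: `n` vectors of `ℝᵏ`, at most `q` of which are non-zero. -/
def nearlyBlack (k n : ℕ) (q : ℝ) : Set (Fin n → EuclideanSpace ℝ (Fin k)) :=
  {θ | (({i | θ i ≠ 0} : Set (Fin n)).ncard : ℝ) ≤ q}

/-- The hyperparameter `c_n = (q_n / n) ^ ((1 + ε_n) / d)`, `ε_n = 1 / log (log (n / q_n))`. -/
noncomputable def scale (d q : ℝ) (n : ℕ) : ℝ :=
  (q / n) ^ ((1 + 1 / Real.log (Real.log (n / q))) / d)

/-! ### The sampling model -/

/-- Density at `x` of the normal distribution `N_k(m, S)`. -/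
noncomputable def gaussianDensity {k : ℕ} (S : Matrix (Fin k) (Fin k) ℝ)
    (m x : EuclideanSpace ℝ (Fin k)) : ℝ :=
  Real.exp (-(mahalanobisSq S (x - m)) / 2) / √((2 * Real.pi) ^ k * S.det)

/-- Law of the data `(X₁, …, X_n)`: independent, `X_i ∼ N_k(θ_i, S)`. -/
noncomputable def dataLaw {k n : ℕ} (S : Matrix (Fin k) (Fin k) ℝ)
    (θ : Fin n → EuclideanSpace ℝ (Fin k)) : Measure (Fin n → EuclideanSpace ℝ (Fin k)) :=
  Measure.pi fun i => multivariateGaussian (θ i) S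

/-- Likelihood of the data `X` at the means `θ`. -/
noncomputable def likelihood {k n : ℕ} (S : Matrix (Fin k) (Fin k) ℝ)
    (X θ : Fin n → EuclideanSpace ℝ (Fin k)) : ℝ :=
  ∏ i, gaussianDensity S (θ i) (X i)

/-! ### The Exponential-Inverse-Gamma prior -/

/-- Inverse-Gamma distribution with shape `a` and scale `b`: density proportional to
`exp (-b / t) * t ^ (-a - 1)` on `t > 0`. -/
noncomputable def invGammaMeasure (a b : ℝ) : Measure ℝ :=
  volume.withDensity fun t => ENNReal.ofReal
    (if 0 < t then b ^ a / Real.Gamma a * Real.exp (-b / t) * t ^ (-a - 1) else 0)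

/-- Law of `(λ², τ)`: independent, `λ²` with density proportional to `exp (-λ² / 2)` and `τ` with
density proportional to `exp (-c / (2 τ)) * τ ^ (-d - 1)`. -/
noncomputable def hyperPrior (d c : ℝ) : Measure (ℝ × ℝ) :=
  (expMeasure (1 / 2)).prod (invGammaMeasure d (c / 2))

/-- Conditional law of one mean given `(λ², τ)`: `N_k(0, λ² τ S)`. -/
noncomputable def meanGivenHyper {k : ℕ} (S : Matrix (Fin k) (Fin k) ℝ) (p : ℝ × ℝ) :
    Measure (EuclideanSpace ℝ (Fin k)) :=
  multivariateGaussian 0 ((p.1 * p.2) • S)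

/-- Prior law of a single mean. -/
noncomputable def priorOne {k : ℕ} (S : Matrix (Fin k) (Fin k) ℝ) (d c : ℝ) :
    Measure (EuclideanSpace ℝ (Fin k)) :=
  (hyperPrior d c).bind (meanGivenHyper S)

/-- Prior law of `(θ₁, …, θ_n)`; the triples `(λ_i², τ_i, θ_i)` are independent and identically
distributed. -/
noncomputable def prior {k : ℕ} (n : ℕ) (S : Matrix (Fin k) (Fin k) ℝ) (d c : ℝ) :
    Measure (Fin n → EuclideanSpace ℝ (Fin k)) :=
  Measure.pi fun _ => priorOne S d c

/-- A normal distribution with scaled covariance is a scaled normal distribution. -/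
theorem meanGivenHyper_eq_map {k : ℕ} {S : Matrix (Fin k) (Fin k) ℝ} (hS : S.PosSemidef)
    (p : ℝ × ℝ) :
    meanGivenHyper S p = (multivariateGaussian 0 S).map (fun z => √(p.1 * p.2) • z) := by
  open scoped MatrixOrder in
  have key : CFC.sqrt ((p.1 * p.2) • S) = √(p.1 * p.2) • CFC.sqrt S := by
    rcases le_or_gt 0 (p.1 * p.2) with h | h
    · apply CFC.sqrt_unique
      · rw [smul_mul_smul_comm, Real.mul_self_sqrt h, CFC.sqrt_mul_sqrt_self S hS.nonneg]
      · exact smul_nonneg (Real.sqrt_nonneg _) (CFC.sqrt_nonneg S)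
    · rw [Real.sqrt_eq_zero_of_nonpos h.le, zero_smul]
      by_cases h0 : ((p.1 * p.2) • S).PosSemidef
      · have h1 : (p.1 * p.2) • S = 0 := by
          refine le_antisymm ?_ h0.nonneg
          have := smul_nonneg (neg_nonneg.2 h.le) hS.nonneg
          rwa [neg_smul, neg_nonneg] at this
        rw [h1, CFC.sqrt_zero]
      · rw [CFC.sqrt, cfcₙ_apply_of_not_predicate]
        change ¬ (((p.1 * p.2) • S) - 0).PosSemidef
        simpa using h0
  rw [meanGivenHyper, multivariateGaussian, multivariateGaussian,
    Measure.map_map (by fun_prop) (by fun_prop), key]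
  congr 1
  ext1 x
  simp

/-- The conditional law depends measurably on `(λ², τ)`, so that the mixture `priorOne` is the
genuine one. -/
theorem measurable_meanGivenHyper {k : ℕ} {S : Matrix (Fin k) (Fin k) ℝ} (hS : S.PosSemidef) :
    Measurable (meanGivenHyper S) := by
  have h : meanGivenHyper S = fun p : ℝ × ℝ =>
      (((multivariateGaussian 0 S).map (Prod.mk p)).map fun y => √(y.1.1 * y.1.2) • y.2) := by
    ext1 p
    rw [meanGivenHyper_eq_map hS, Measure.map_map (by fun_prop) (by fun_prop)]
    rfl
  rw [h]
  exact (Measure.measurable_map _ (by fun_prop)).comp Measurable.map_prodMk_left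

/-! ### Posterior and Bayes estimator -/

/-- Bayes' formula: the posterior distribution for a prior `π` and a likelihood `l`. -/
noncomputable def bayes {Θ : Type*} [MeasurableSpace Θ] (π : Measure Θ) (l : Θ → ℝ) : Measure Θ :=
  (∫⁻ θ, ENNReal.ofReal (l θ) ∂π)⁻¹ • π.withDensity fun θ => ENNReal.ofReal (l θ)

/-- Posterior distribution of `(θ₁, …, θ_n)` given the data `X = (X₁, …, X_n)`. -/
noncomputable def posterior {k n : ℕ} (S : Matrix (Fin k) (Fin k) ℝ) (d c : ℝ)
    (X : Fin n → EuclideanSpace ℝ (Fin k)) : Measure (Fin n → EuclideanSpace ℝ (Fin k)) :=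
  bayes (prior n S d c) (likelihood S X)

/-- Bayes estimator of one mean: the posterior mean `E(θ_i | X_i = x)`. -/
noncomputable def estimator {k : ℕ} (S : Matrix (Fin k) (Fin k) ℝ) (d c : ℝ)
    (x : EuclideanSpace ℝ (Fin k)) : EuclideanSpace ℝ (Fin k) :=
  ∫ t, t ∂(bayes (priorOne S d c) fun t => gaussianDensity S t x)

/-- `E_{θ₀} Π(∑ i, N (θ_i - centre_i(X)) > r | X)` for the squared norm `N`: expectation, over data
with true means `θ₀`, of the posterior probability of missing the ball of squared radius `r` around
`centre X`. -/
noncomputable def missProb {k n : ℕ} (S : Matrix (Fin k) (Fin k) ℝ) (d c : ℝ)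
    (N : EuclideanSpace ℝ (Fin k) → ℝ)
    (centre : (Fin n → EuclideanSpace ℝ (Fin k)) → Fin n → EuclideanSpace ℝ (Fin k)) (r : ℝ)
    (θ₀ : Fin n → EuclideanSpace ℝ (Fin k)) : ℝ≥0∞ :=
  ∫⁻ X, posterior S d c X {θ | r < ∑ i, N (θ i - centre X i)} ∂(dataLaw S θ₀)

end EIG

/-! After whitening by `S ^ (1 / 2)` the problem has identity covariance. Given `u = λ² τ` and an
observation `y`, the posterior of a mean is `N(v y, v I)` with `v = u / (1 + u)`. Integrating out
the hyperparameters leaves a law of `v` on `[0, 1]` which is the exponential tilt, with parameter `s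
= ‖y‖² / 2`, of one fixed measure `mixing` (`bayes_priorOne`). Posterior second moments thus reduce
to moments of a one-parameter exponential family. The posterior is a product measure, so Markov's
inequality reduces both claims to sums over `i` of single-mean expectations
(`missProb_le_of_nearlyBlack`). Write `L = log (n / q)`.

Zero means. Evidence at `y` is at least a constant times the density of `N(0, I)`. The sampling
expectation at `0` of the posterior mean of `v` is therefore at most a constant times the prior mean
of `v` (`lintegral_tiltMean_le`), which is `O(c ^ d) = O((q / n) exp (-L / log L))`. Multiplying by
`‖y‖² ≤ 4 L`, and bounding the tail beyond by `exp (-3 L / 2)`, makes the `n` zero means contribute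
`o(q L)`.

Non-zero means, distance to the truth. The prior gives mass of order at least `c ^ d / s` to `1 - v
≍ 1 / s`, so the exponential moment of `mixing` is at least of order `c ^ d e ^ s / s ^ (k + 1)`
(`le_integral_exp_mixing`). This forces `s E (1 - v)² = O(1 + L² / s)` under the tilt
(`tiltGap_mixing_le`), hence `‖y‖² E (1 - v)² = O(L)` for every `y`: a cost `O(q L)` in total,
beaten by `M_n`.

Non-zero means, distance to the posterior mean. Here the radius carries no `M_n`, so `o(L)` per mean
is needed, uniformly in the true mean. The term to control is `‖y‖² Var(v)`. The variance of the
tilt is the derivative in `s` of its mean, and that mean stays in `[0, 1]`; hence `|t| Var(v)` has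
integral at most `2` along every coordinate line, whatever the other coordinates
(`lintegral_abs_mul_tiltVar_le`). As the Gaussian density is bounded, `E |y_j| Var(v) ≤ 1` for every
true mean. On `‖y‖ ≤ r` this bounds the expectation by `k r`; on `‖y‖ ≥ r` the bound on `1 - v`
gives `O(1 + L² / r²)`. The choice `r = L ^ (3 / 4)` makes both `o(L)`. -/

namespace EIG

/-! ### The standard Gaussian measure: density and conjugacy -/

section Gaussian

variable {E : Type*} [NormedAddCommGroup E] [InnerProductSpace ℝ E] [FiniteDimensional ℝ E]
  [MeasurableSpace E] [BorelSpace E]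

variable (E) in
/-- Normalising constant of the standard Gaussian density. -/
noncomputable def gaussianConst : ℝ := (2 * Real.pi) ^ (-(Module.finrank ℝ E : ℝ) / 2)

omit [FiniteDimensional ℝ E] [MeasurableSpace E] [BorelSpace E] in
variable (E) in
theorem gaussianConst_pos : 0 < gaussianConst E := by
  unfold gaussianConst; positivity

omit [FiniteDimensional ℝ E] [MeasurableSpace E] [BorelSpace E] in
theorem gaussianConst_mul_cpow :
    (gaussianConst E : ℂ) * ((Real.pi : ℂ) / (1 / 2 : ℂ)) ^ (Module.finrank ℝ E / 2 : ℂ) = 1 := by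
  have h : ((Real.pi : ℂ) / (1 / 2 : ℂ)) = ((2 * Real.pi : ℝ) : ℂ) := by push_cast; ring
  have h2 : (Module.finrank ℝ E / 2 : ℂ) = ((Module.finrank ℝ E / 2 : ℝ) : ℂ) := by push_cast; ring
  rw [h, h2, ← Complex.ofReal_cpow (by positivity), gaussianConst, ← Complex.ofReal_mul,
    ← Real.rpow_add (by positivity)]
  simp [neg_div]

/-- Both sides are finite measures, so characteristic functions decide; on the right it is a
Gaussian Fourier integral. -/
theorem stdGaussian_eq_withDensity :
    stdGaussian E = (volume : Measure E).withDensity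
      fun z => ENNReal.ofReal (gaussianConst E * Real.exp (-‖z‖ ^ 2 / 2)) := by
  have hint : Integrable (fun z : E => gaussianConst E * Real.exp (-‖z‖ ^ 2 / 2)) := by
    refine Integrable.const_mul ?_ _
    have h := (GaussianFourier.integrable_cexp_neg_mul_sq_norm_add (b := 1 / 2) (by norm_num) 0
      (0 : E)).norm
    refine h.congr (Eventually.of_forall fun z => ?_)
    simp only [Complex.norm_exp]
    congr 1
    simp [← Complex.ofReal_pow]
    ring
  have : IsFiniteMeasure ((volume : Measure E).withDensity
      fun z => ENNReal.ofReal (gaussianConst E * Real.exp (-‖z‖ ^ 2 / 2))) :=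
    isFiniteMeasure_withDensity_ofReal hint.2
  refine Measure.ext_of_charFun ?_
  ext t
  rw [charFun_stdGaussian, charFun_apply, integral_withDensity_eq_integral_toReal_smul
    (by fun_prop) (by simp)]
  have h1 : ∀ z : E, (ENNReal.ofReal (gaussianConst E * Real.exp (-‖z‖ ^ 2 / 2))).toReal •
      Complex.exp (inner ℝ z t * Complex.I) = (gaussianConst E : ℂ) *
        Complex.exp (-(1 / 2 : ℂ) * ‖z‖ ^ 2 + Complex.I * inner ℝ t z) := by
    intro z
    have := gaussianConst_pos E
    rw [ENNReal.toReal_ofReal (by positivity), Complex.real_smul]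
    push_cast
    rw [mul_assoc, ← Complex.exp_add, real_inner_comm]
    congr 2
    ring
  simp_rw [h1]
  rw [integral_const_mul, GaussianFourier.integral_cexp_neg_mul_sq_norm_add (by norm_num),
    ← mul_assoc, gaussianConst_mul_cpow, one_mul]
  congr 1
  simp
  ring

theorem lintegral_stdGaussian {f : E → ℝ≥0∞} (hf : Measurable f) :
    ∫⁻ z, f z ∂(stdGaussian E) =
      ∫⁻ z, ENNReal.ofReal (gaussianConst E * Real.exp (-‖z‖ ^ 2 / 2)) * f z := by
  rw [stdGaussian_eq_withDensity, lintegral_withDensity_eq_lintegral_mul _ (by fun_prop) hf]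
  rfl

theorem lintegral_comp_affine {b : ℝ} (hb : 0 < b) (x : E) {f : E → ℝ≥0∞} (hf : Measurable f) :
    ∫⁻ z, f z = ENNReal.ofReal (b ^ Module.finrank ℝ E) * ∫⁻ w, f (b • w + x) := by
  rw [lintegral_add_right_eq_self (fun w => f w) x |>.symm]
  have h := Measure.map_addHaar_smul (volume : Measure E) hb.ne'
  have h2 : ∫⁻ w, f (b • w + x) = ∫⁻ z, f (z + x) ∂(Measure.map (b • ·) (volume : Measure E)) := by
    rw [lintegral_map (by fun_prop) (by fun_prop)]
  rw [h2, h, lintegral_smul_measure, smul_eq_mul, ← mul_assoc,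
    ← ENNReal.ofReal_mul (by positivity), abs_of_pos (by positivity),
    mul_inv_cancel₀ (by positivity), ENNReal.ofReal_one, one_mul]

omit [FiniteDimensional ℝ E] [MeasurableSpace E] [BorelSpace E] in
-- The substituted point has the posterior mean `a / (1 + a²) • y` and posterior standard deviation
-- `1 / √(1 + a²)` of `z` given `y = a z + noise`, which is why no cross term in `y` and `w`
-- survives.
theorem norm_sq_complete_square (a : ℝ) (y w : E) :
    ‖y - a • ((1 / √(1 + a ^ 2)) • w + (a / (1 + a ^ 2)) • y)‖ ^ 2 +
      ‖(1 / √(1 + a ^ 2)) • w + (a / (1 + a ^ 2)) • y‖ ^ 2 =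
      (1 - a ^ 2 / (1 + a ^ 2)) * ‖y‖ ^ 2 + ‖w‖ ^ 2 := by
  have h : 0 < 1 + a ^ 2 := by positivity
  have hs : √(1 + a ^ 2) ^ 2 = 1 + a ^ 2 := Real.sq_sqrt h.le
  set r := √(1 + a ^ 2)
  have hr : r ≠ 0 := by rintro h0; rw [h0] at hs; nlinarith
  rw [← hs]
  rw [norm_sub_sq_real, norm_smul, mul_pow, inner_smul_right, inner_add_right, norm_add_sq_real]
  simp only [norm_smul, mul_pow, inner_smul_right, inner_smul_left, Real.norm_eq_abs, sq_abs,
    real_inner_self_eq_norm_sq, real_inner_comm y w, RCLike.conj_to_real]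
  have ha : a ^ 2 = r ^ 2 - 1 := by linarith
  field_simp
  have ha4 : a ^ 4 = (r ^ 2 - 1) ^ 2 := by rw [← ha]; ring
  have ha3 : a ^ 3 = a * (r ^ 2 - 1) := by rw [← ha]; ring
  ring_nf
  simp only [ha, ha3, ha4]
  ring

/-- Conjugacy of the normal prior `N(0, a² I)` and the normal likelihood. -/
theorem lintegral_stdGaussian_conj {a : ℝ} (ha : 0 ≤ a) (y : E) {g : E → ℝ≥0∞}
    (hg : Measurable g) :
    ∫⁻ z, ENNReal.ofReal (Real.exp (-‖y - a • z‖ ^ 2 / 2)) * g (a • z) ∂(stdGaussian E) =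
      ENNReal.ofReal (√(1 - a ^ 2 / (1 + a ^ 2)) ^ Module.finrank ℝ E *
        Real.exp (-((1 - a ^ 2 / (1 + a ^ 2)) * ‖y‖ ^ 2) / 2)) *
      ∫⁻ w, g ((a ^ 2 / (1 + a ^ 2)) • y + √(a ^ 2 / (1 + a ^ 2)) • w) ∂(stdGaussian E) := by
  have h : 0 < 1 + a ^ 2 := by positivity
  have hb : 0 < 1 / √(1 + a ^ 2) := by positivity
  have hK := gaussianConst_pos E
  have hv : √(1 - a ^ 2 / (1 + a ^ 2)) = 1 / √(1 + a ^ 2) := by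
    rw [show 1 - a ^ 2 / (1 + a ^ 2) = (1 + a ^ 2)⁻¹ by field_simp; ring, Real.sqrt_inv, one_div]
  have hv2 : √(a ^ 2 / (1 + a ^ 2)) = a * (1 / √(1 + a ^ 2)) := by
    rw [Real.sqrt_div (by positivity), Real.sqrt_sq ha]; ring
  rw [lintegral_stdGaussian (by fun_prop), lintegral_stdGaussian (by fun_prop),
    lintegral_comp_affine hb ((a / (1 + a ^ 2)) • y) (by fun_prop),
    ← hv, ENNReal.ofReal_mul (by positivity), mul_assoc]
  congr 1
  rw [← lintegral_const_mul _ (by fun_prop), hv]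
  refine lintegral_congr fun w => ?_
  rw [← mul_assoc, ← mul_assoc, ← ENNReal.ofReal_mul (by positivity),
    ← ENNReal.ofReal_mul (by positivity)]
  congr 2
  · rw [mul_assoc, ← Real.exp_add, mul_left_comm, ← Real.exp_add]
    congr 2
    have := norm_sq_complete_square a y w
    linarith
  · rw [hv2, smul_add, smul_smul, smul_smul, add_comm]
    congr 2
    ring

/-- Rescaling by `1 / √(1 - v)` restores the standard density. The resulting power later cancels the
weight in `mixing`. -/
theorem lintegral_exp_mul_norm_sq_stdGaussian {v : ℝ} (hv : v < 1) :
    ∫⁻ y, ENNReal.ofReal (Real.exp (v * ‖y‖ ^ 2 / 2)) ∂(stdGaussian E) =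
      ENNReal.ofReal ((1 / √(1 - v)) ^ Module.finrank ℝ E) := by
  have h : 0 < 1 - v := by linarith
  have hK := gaussianConst_pos E
  have hb : 0 < 1 / √(1 - v) := by positivity
  rw [lintegral_stdGaussian (by fun_prop), lintegral_comp_affine hb 0 (by fun_prop)]
  have h1 : ∫⁻ w : E, ENNReal.ofReal (gaussianConst E * Real.exp (-‖w‖ ^ 2 / 2)) = 1 := by
    have h2 := lintegral_stdGaussian (E := E) (f := fun _ => 1) (by fun_prop)
    simpa using h2.symm
  refine Eq.trans ?_ (mul_one _)
  congr 1
  rw [← h1]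
  refine lintegral_congr fun w => ?_
  rw [← ENNReal.ofReal_mul (by positivity), mul_assoc, ← Real.exp_add, add_zero, norm_smul,
    mul_pow, Real.norm_eq_abs, sq_abs, div_pow, Real.sq_sqrt h.le]
  congr 3
  field_simp
  ring

theorem lintegral_norm_sq_stdGaussian :
    ∫⁻ w, ENNReal.ofReal (‖w‖ ^ 2) ∂(stdGaussian E) = ENNReal.ofReal (Module.finrank ℝ E) := by
  rw [stdGaussian_eq_map_pi_orthonormalBasis (stdOrthonormalBasis ℝ E),
    lintegral_map (by fun_prop) (by fun_prop)]
  have h1 : ∀ x : Fin (Module.finrank ℝ E) → ℝ,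
      ENNReal.ofReal (‖∑ i, x i • stdOrthonormalBasis ℝ E i‖ ^ 2) =
        ∑ i, ENNReal.ofReal (x i ^ 2) := by
    intro x
    rw [← (stdOrthonormalBasis ℝ E).sum_sq_norm_inner_right,
      ENNReal.ofReal_sum_of_nonneg (fun _ _ => by positivity)]
    refine Finset.sum_congr rfl fun i _ => ?_
    rw [inner_sum]
    simp [inner_smul_right, orthonormal_iff_ite.1 (stdOrthonormalBasis ℝ E).orthonormal]
  simp_rw [h1]
  rw [lintegral_finsetSum _ (by fun_prop)]
  have h2 : ∀ i : Fin (Module.finrank ℝ E), ∫⁻ x : Fin (Module.finrank ℝ E) → ℝ,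
      ENNReal.ofReal (x i ^ 2) ∂(Measure.pi fun _ => gaussianReal 0 1) = 1 := by
    intro i
    rw [(measurePreserving_eval (fun _ => gaussianReal 0 1) i).lintegral_comp
      (f := fun t => ENNReal.ofReal (t ^ 2)) (by fun_prop)]
    have h3 := variance_id_gaussianReal (μ := 0) (v := 1)
    rw [variance_eq_integral (by fun_prop)] at h3
    simp only [id, integral_id_gaussianReal, sub_zero] at h3
    rw [← ofReal_integral_eq_lintegral_ofReal, h3]
    · simp
    · exact (memLp_id_gaussianReal 2).integrable_sq
    · exact Eventually.of_forall fun t => by positivity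
  simp [h2]

end Gaussian

/-! ### Whitening -/

section Whitening

open scoped MatrixOrder

variable {k : ℕ} {S : Matrix (Fin k) (Fin k) ℝ}

/-- The linear map with matrix `S ^ (1 / 2)`. -/
noncomputable def sqrtCLM (S : Matrix (Fin k) (Fin k) ℝ) :
    EuclideanSpace ℝ (Fin k) →L[ℝ] EuclideanSpace ℝ (Fin k) :=
  Matrix.toEuclideanCLM (𝕜 := ℝ) (CFC.sqrt S)

theorem sqrt_mul_sqrt_of_posDef (hS : S.PosDef) : CFC.sqrt S * CFC.sqrt S = S :=
  CFC.sqrt_mul_sqrt_self S hS.posSemidef.nonneg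

theorem transpose_sqrt (S : Matrix (Fin k) (Fin k) ℝ) : (CFC.sqrt S)ᵀ = CFC.sqrt S := by
  have h : (CFC.sqrt S).IsHermitian := (CFC.sqrt_nonneg S).isSelfAdjoint
  simpa [Matrix.IsHermitian] using h

theorem isUnit_det_sqrt (hS : S.PosDef) : IsUnit (CFC.sqrt S).det := by
  refine isUnit_iff_ne_zero.2 fun h => hS.det_pos.ne' ?_
  rw [← sqrt_mul_sqrt_of_posDef hS, Matrix.det_mul, h, zero_mul]

/-- This identity permits all later work in whitened coordinates. -/
theorem mahalanobisSq_sqrtCLM (hS : S.PosDef) (z : EuclideanSpace ℝ (Fin k)) :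
    mahalanobisSq S (sqrtCLM S z) = ‖z‖ ^ 2 := by
  have hu := isUnit_det_sqrt hS
  have hinv : S⁻¹ = (CFC.sqrt S)⁻¹ * (CFC.sqrt S)⁻¹ := by
    rw [← Matrix.mul_inv_rev, sqrt_mul_sqrt_of_posDef hS]
  rw [mahalanobisSq, sqrtCLM, Matrix.ofLp_toEuclideanCLM, hinv, Matrix.mulVec_mulVec,
    Matrix.mul_assoc, Matrix.nonsing_inv_mul _ hu, Matrix.mul_one, Matrix.dotProduct_mulVec,
    ← Matrix.mulVec_transpose, Matrix.mulVec_mulVec, Matrix.transpose_nonsing_inv,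
    transpose_sqrt, Matrix.nonsing_inv_mul _ hu, Matrix.one_mulVec, EuclideanSpace.real_norm_sq_eq]
  simp [dotProduct, sq]

theorem sqrtCLM_surjective (hS : S.PosDef) : Function.Surjective (sqrtCLM S) := by
  intro x
  refine ⟨Matrix.toEuclideanCLM (𝕜 := ℝ) (CFC.sqrt S)⁻¹ x, ?_⟩
  rw [sqrtCLM, ← mul_apply_eq_comp, ← map_mul,
    Matrix.mul_nonsing_inv _ (isUnit_det_sqrt hS), map_one]
  rfl

theorem multivariateGaussian_eq_map_sqrtCLM (m : EuclideanSpace ℝ (Fin k)) :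
    multivariateGaussian m S =
      (stdGaussian (EuclideanSpace ℝ (Fin k))).map fun z => m + sqrtCLM S z := rfl

/-- Normalising constant of the density of `N_k(m, S)`. -/
noncomputable def densityConst (S : Matrix (Fin k) (Fin k) ℝ) : ℝ :=
  (√((2 * Real.pi) ^ k * S.det))⁻¹

theorem densityConst_pos (hS : S.PosDef) : 0 < densityConst S := by
  have := hS.det_pos
  unfold densityConst
  positivity

theorem gaussianDensity_sqrtCLM (hS : S.PosDef) (t y : EuclideanSpace ℝ (Fin k)) :
    gaussianDensity S (sqrtCLM S t) (sqrtCLM S y) =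
      densityConst S * Real.exp (-‖y - t‖ ^ 2 / 2) := by
  rw [gaussianDensity, ← map_sub, mahalanobisSq_sqrtCLM hS, densityConst]
  ring

theorem measurable_mahalanobisSq (S : Matrix (Fin k) (Fin k) ℝ) :
    Measurable (mahalanobisSq S) := by
  have h : mahalanobisSq S = fun x => ∑ i, x i * ∑ j, S⁻¹ i j * x j := by
    ext x
    simp [mahalanobisSq, dotProduct, Matrix.mulVec]
  rw [h]
  fun_prop

theorem measurable_gaussianDensity (S : Matrix (Fin k) (Fin k) ℝ)
    (x : EuclideanSpace ℝ (Fin k)) : Measurable fun t => gaussianDensity S t x := by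
  have := measurable_mahalanobisSq S
  unfold gaussianDensity
  fun_prop

theorem gaussianDensity_nonneg (t x : EuclideanSpace ℝ (Fin k)) : 0 ≤ gaussianDensity S t x := by
  unfold gaussianDensity
  positivity

end Whitening

/-! ### The posterior of one mean -/

/-- The factor `u / (1 + u)`, with `u = λ² τ`. -/
noncomputable def shrink (p : ℝ × ℝ) : ℝ := √(p.1 * p.2) ^ 2 / (1 + √(p.1 * p.2) ^ 2)

theorem measurable_shrink : Measurable shrink := by
  unfold shrink
  fun_prop

theorem shrink_nonneg (p : ℝ × ℝ) : 0 ≤ shrink p := by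
  unfold shrink
  positivity

theorem shrink_lt_one (p : ℝ × ℝ) : shrink p < 1 := by
  have : 0 < 1 + √(p.1 * p.2) ^ 2 := by positivity
  rw [shrink, div_lt_one this]
  linarith

/-- Law of the shrinkage factor under the prior, weighted by `(1 - v) ^ (k / 2)`. -/
noncomputable def mixing (k : ℕ) (d c : ℝ) : Measure ℝ :=
  ((hyperPrior d c).map shrink).withDensity fun v => ENNReal.ofReal (√(1 - v) ^ k)

theorem lintegral_mixing (k : ℕ) (d c : ℝ) {f : ℝ → ℝ≥0∞} (hf : Measurable f) :
    ∫⁻ v, f v ∂(mixing k d c) =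
      ∫⁻ p, ENNReal.ofReal (√(1 - shrink p) ^ k) * f (shrink p) ∂(hyperPrior d c) := by
  rw [mixing, lintegral_withDensity_eq_lintegral_mul _ (by fun_prop) hf,
    lintegral_map (by fun_prop) measurable_shrink]
  rfl

theorem ae_mixing (k : ℕ) (d c : ℝ) : ∀ᵐ v ∂(mixing k d c), v ∈ Set.Icc (0 : ℝ) 1 := by
  refine (withDensity_absolutelyContinuous _ _).ae_le ?_
  refine (ae_map_iff (p := (· ∈ Set.Icc (0 : ℝ) 1)) measurable_shrink.aemeasurable
    measurableSet_Icc).2 ?_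
  exact Eventually.of_forall fun p => ⟨shrink_nonneg p, (shrink_lt_one p).le⟩

section Mixing

variable {k : ℕ} {d c : ℝ} [IsProbabilityMeasure (hyperPrior d c)]

theorem mixing_univ_le_one : mixing k d c Set.univ ≤ 1 := by
  rw [← lintegral_one, lintegral_mixing _ _ _ (by fun_prop)]
  calc _ ≤ ∫⁻ _, 1 ∂(hyperPrior d c) := by
        refine lintegral_mono fun p => ?_
        rw [mul_one, ENNReal.ofReal_le_one]
        refine pow_le_one₀ (Real.sqrt_nonneg _) (Real.sqrt_le_one.2 ?_)
        linarith [shrink_nonneg p]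
    _ = 1 := by simp

instance isFiniteMeasure_mixing : IsFiniteMeasure (mixing k d c) :=
  ⟨mixing_univ_le_one.trans_lt ENNReal.one_lt_top⟩

instance neZero_mixing : NeZero (mixing k d c) := by
  refine ⟨fun h => ?_⟩
  have h1 : ∫⁻ _, 1 ∂(mixing k d c) = 0 := by rw [h, lintegral_zero_measure]
  rw [lintegral_mixing _ _ _ (by fun_prop), lintegral_eq_zero_iff
    (by have := measurable_shrink; fun_prop)] at h1
  have h2 : ∀ᵐ p ∂(hyperPrior d c), False := by
    filter_upwards [h1] with p hp
    have : 0 < 1 - shrink p := by linarith [shrink_lt_one p]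
    have h3 : 0 < √(1 - shrink p) ^ k := by positivity
    simp only [mul_one, Pi.zero_apply, ENNReal.ofReal_eq_zero] at hp
    linarith
  simp at h2
  exact IsProbabilityMeasure.ne_zero _ h2

end Mixing

theorem integrable_exp_mul_of_mem_Icc {μ : Measure ℝ} [IsFiniteMeasure μ]
    (hμ : ∀ᵐ v ∂μ, v ∈ Set.Icc (0 : ℝ) 1) (s : ℝ) :
    Integrable (fun v => Real.exp (s * v)) μ := by
  refine Integrable.of_bound (by fun_prop) (Real.exp |s|) ?_
  filter_upwards [hμ] with v hv
  rw [Real.norm_eq_abs, Real.abs_exp, Real.exp_le_exp]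
  calc s * v ≤ |s| * v := by gcongr; exacts [hv.1, le_abs_self s]
    _ ≤ |s| * 1 := by gcongr; exact hv.2
    _ = |s| := mul_one _

section OneMean

variable {k : ℕ} {S : Matrix (Fin k) (Fin k) ℝ} {d c : ℝ}

theorem lintegral_priorOne (hS : S.PosDef) {g : EuclideanSpace ℝ (Fin k) → ℝ≥0∞}
    (hg : Measurable g) :
    ∫⁻ t, g t ∂(priorOne S d c) = ∫⁻ p, ∫⁻ z, g (sqrtCLM S (√(p.1 * p.2) • z))
      ∂(stdGaussian (EuclideanSpace ℝ (Fin k))) ∂(hyperPrior d c) := by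
  rw [priorOne, Measure.lintegral_bind (measurable_meanGivenHyper hS.posSemidef).aemeasurable
    hg.aemeasurable]
  refine lintegral_congr fun p => ?_
  rw [meanGivenHyper_eq_map hS.posSemidef, multivariateGaussian_eq_map_sqrtCLM,
    Measure.map_map (by fun_prop) (by fun_prop), lintegral_map hg (by fun_prop)]
  simp

/-- By conjugacy, a given `v` carries marginal likelihood proportional to `(1 - v) ^ (k / 2) * exp
(-(1 - v) ‖y‖² / 2)`. The power goes into `mixing`; pulling out `exp (-‖y‖² / 2)` leaves the
exponential tilt. -/
theorem lintegral_priorOne_mul_density (hS : S.PosDef) (y : EuclideanSpace ℝ (Fin k))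
    {g : EuclideanSpace ℝ (Fin k) → ℝ≥0∞} (hg : Measurable g) :
    ∫⁻ t, ENNReal.ofReal (gaussianDensity S t (sqrtCLM S y)) * g t ∂(priorOne S d c) =
      ENNReal.ofReal (densityConst S * Real.exp (-‖y‖ ^ 2 / 2)) *
        ∫⁻ v, ENNReal.ofReal (Real.exp (‖y‖ ^ 2 / 2 * v)) * ∫⁻ w, g (sqrtCLM S (v • y + √v • w))
          ∂(stdGaussian (EuclideanSpace ℝ (Fin k))) ∂(mixing k d c) := by
  have hK := densityConst_pos hS
  have hm := measurable_gaussianDensity S (sqrtCLM S y)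
  have hinner : Measurable fun v : ℝ => ∫⁻ w, g (sqrtCLM S (v • y + √v • w))
      ∂(stdGaussian (EuclideanSpace ℝ (Fin k))) :=
    Measurable.lintegral_prod_right' (f := fun q : ℝ × EuclideanSpace ℝ (Fin k) =>
      g (sqrtCLM S (q.1 • y + √q.1 • q.2))) (by fun_prop)
  have hms := measurable_shrink
  rw [lintegral_priorOne hS (by fun_prop), lintegral_mixing _ _ _ (by fun_prop),
    ← lintegral_const_mul _ (by fun_prop)]
  refine lintegral_congr fun p => ?_
  have h1 := lintegral_stdGaussian_conj (Real.sqrt_nonneg (p.1 * p.2)) y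
    (g := fun t => g (sqrtCLM S t)) (by fun_prop)
  simp_rw [gaussianDensity_sqrtCLM hS, ENNReal.ofReal_mul hK.le, mul_assoc]
  rw [lintegral_const_mul _ (by fun_prop), h1, finrank_euclideanSpace_fin]
  change _ * (ENNReal.ofReal (√(1 - shrink p) ^ k * Real.exp (-((1 - shrink p) * _) / 2)) *
    ∫⁻ w, g (sqrtCLM S (shrink p • y + √(shrink p) • w)) ∂_) = _
  simp only [← mul_assoc]
  congr 1
  rw [mul_assoc, mul_assoc, ← ENNReal.ofReal_mul (by positivity),
    ← ENNReal.ofReal_mul (by positivity), ← ENNReal.ofReal_mul (by positivity),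
    ← ENNReal.ofReal_mul (by positivity)]
  congr 2
  rw [mul_left_comm, ← Real.exp_add]
  congr 2
  ring

variable [IsProbabilityMeasure (hyperPrior d c)]

theorem lintegral_mixing_exp (s : ℝ) :
    ∫⁻ v, ENNReal.ofReal (Real.exp (s * v)) ∂(mixing k d c) =
      ENNReal.ofReal (∫ v, Real.exp (s * v) ∂(mixing k d c)) :=
  (ofReal_integral_eq_lintegral_ofReal (integrable_exp_mul_of_mem_Icc (ae_mixing k d c) s)
    (Eventually.of_forall fun _ => (Real.exp_pos _).le)).symm

theorem integral_mixing_exp_pos (s : ℝ) : 0 < ∫ v, Real.exp (s * v) ∂(mixing k d c) :=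
  integral_exp_pos (integrable_exp_mul_of_mem_Icc (ae_mixing k d c) s)

theorem evidence_eq (hS : S.PosDef) (y : EuclideanSpace ℝ (Fin k)) :
    ∫⁻ t, ENNReal.ofReal (gaussianDensity S t (sqrtCLM S y)) ∂(priorOne S d c) =
      ENNReal.ofReal (densityConst S * Real.exp (-‖y‖ ^ 2 / 2)) *
        ENNReal.ofReal (∫ v, Real.exp (‖y‖ ^ 2 / 2 * v) ∂(mixing k d c)) := by
  have h := lintegral_priorOne_mul_density (d := d) (c := c) hS y (g := fun _ => 1) (by fun_prop)
  simp only [mul_one, lintegral_const, measure_univ] at h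
  rw [h, lintegral_mixing_exp]

/-- Given the shrinkage factor `v`, the posterior of a mean is `N(v x, v S)`; the posterior law of
`v` is an exponential tilt of `mixing`. -/
theorem bayes_priorOne (hS : S.PosDef) (y : EuclideanSpace ℝ (Fin k)) :
    bayes (priorOne S d c) (fun t => gaussianDensity S t (sqrtCLM S y)) =
      (((mixing k d c).tilted fun v => ‖y‖ ^ 2 / 2 * v).prod
        (stdGaussian (EuclideanSpace ℝ (Fin k)))).map
        fun q => sqrtCLM S (q.1 • y + √q.1 • q.2) := by
  have hK := densityConst_pos hS
  have hm := measurable_gaussianDensity S (sqrtCLM S y)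
  have hI := integral_mixing_exp_pos (k := k) (d := d) (c := c) (‖y‖ ^ 2 / 2)
  refine Measure.ext_of_lintegral _ fun g hg => ?_
  have hinner : Measurable fun v : ℝ => ∫⁻ w, g (sqrtCLM S (v • y + √v • w))
      ∂(stdGaussian (EuclideanSpace ℝ (Fin k))) :=
    Measurable.lintegral_prod_right' (f := fun q : ℝ × EuclideanSpace ℝ (Fin k) =>
      g (sqrtCLM S (q.1 • y + √q.1 • q.2))) (by fun_prop)
  have hprob : IsProbabilityMeasure ((mixing k d c).tilted fun v => ‖y‖ ^ 2 / 2 * v) :=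
    isProbabilityMeasure_tilted (integrable_exp_mul_of_mem_Icc (ae_mixing k d c) _)
  rw [bayes, lintegral_smul_measure, lintegral_withDensity_eq_lintegral_mul _ (by fun_prop) hg,
    lintegral_map hg (by fun_prop), lintegral_prod _ (by fun_prop), lintegral_tilted,
    evidence_eq hS]
  simp only [Pi.mul_apply]
  rw [lintegral_priorOne_mul_density hS y hg, smul_eq_mul, ← ENNReal.ofReal_mul (by positivity),
    ← ENNReal.ofReal_inv_of_pos (by positivity), ← mul_assoc,
    ← ENNReal.ofReal_mul (by positivity), ← lintegral_const_mul _ (by fun_prop)]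
  refine lintegral_congr fun v => ?_
  rw [← mul_assoc, ← ENNReal.ofReal_mul (by positivity)]
  congr 2
  field_simp

instance isProbabilityMeasure_tilted_mixing (s : ℝ) :
    IsProbabilityMeasure ((mixing k d c).tilted fun v => s * v) :=
  isProbabilityMeasure_tilted (integrable_exp_mul_of_mem_Icc (ae_mixing k d c) _)

theorem isProbabilityMeasure_bayes_priorOne (hS : S.PosDef) (x : EuclideanSpace ℝ (Fin k)) :
    IsProbabilityMeasure (bayes (priorOne S d c) fun t => gaussianDensity S t x) := by
  obtain ⟨y, rfl⟩ := sqrtCLM_surjective hS x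
  rw [bayes_priorOne hS]
  exact Measure.isProbabilityMeasure_map (by fun_prop)

theorem isProbabilityMeasure_priorOne (hS : S.PosDef) :
    IsProbabilityMeasure (priorOne S d c) := by
  constructor
  rw [← lintegral_one, lintegral_priorOne hS (by fun_prop)]
  simp

theorem estimator_sqrtCLM (hS : S.PosDef) (y : EuclideanSpace ℝ (Fin k)) :
    estimator S d c (sqrtCLM S y) =
      sqrtCLM S ((∫ v, v ∂((mixing k d c).tilted fun v => ‖y‖ ^ 2 / 2 * v)) • y) := by
  set ρ := (mixing k d c).tilted fun v => ‖y‖ ^ 2 / 2 * v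
  have hρ : ∀ᵐ v ∂ρ, v ∈ Set.Icc (0 : ℝ) 1 :=
    (tilted_absolutelyContinuous _ _).ae_le (ae_mixing k d c)
  have h1 : Integrable (fun v => v) ρ := by
    refine Integrable.of_bound (by fun_prop) 1 ?_
    filter_upwards [hρ] with v hv
    rw [Real.norm_eq_abs, abs_of_nonneg hv.1]
    exact hv.2
  have h2 : Integrable (fun v => √v) ρ := by
    refine Integrable.of_bound (by fun_prop) 1 ?_
    filter_upwards [hρ] with v hv
    rw [Real.norm_eq_abs, abs_of_nonneg (Real.sqrt_nonneg _)]
    exact Real.sqrt_le_one.2 hv.2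
  have h3 : Integrable (fun w : EuclideanSpace ℝ (Fin k) => w) (stdGaussian _) :=
    IsGaussian.integrable_id
  have h4 : Integrable (fun q : ℝ × EuclideanSpace ℝ (Fin k) => q.1 • y)
      (ρ.prod (stdGaussian (EuclideanSpace ℝ (Fin k)))) :=
    (h1.comp_fst _).smul_const y
  have h5 : Integrable (fun q : ℝ × EuclideanSpace ℝ (Fin k) => √q.1 • q.2)
      (ρ.prod (stdGaussian (EuclideanSpace ℝ (Fin k)))) := h2.smul_prod h3
  have h6 := ContinuousLinearMap.integral_comp_comm (sqrtCLM S) (h4.add h5)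
  simp only [Pi.add_apply] at h6
  rw [estimator, bayes_priorOne hS, integral_map (by fun_prop) (by fun_prop)]
  refine h6.trans ?_
  -- The noise `√v • w` is centred, so only the mean of `v` survives.
  rw [integral_add h4 h5,
    integral_prod_smul (μ := ρ) (fun v : ℝ => √v) (fun w : EuclideanSpace ℝ (Fin k) => w),
    integral_id_stdGaussian, smul_zero, add_zero, integral_smul_const]
  congr 2
  rw [integral_fun_fst (μ := ρ) (fun v => v)]
  simp

end OneMean

/-! ### The posterior of all means -/

theorem setLIntegral_univ_pi_prod {n : ℕ} {Θ : Type*} [MeasurableSpace Θ] {π : Measure Θ}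
    [IsProbabilityMeasure π] {l : Fin n → Θ → ℝ≥0∞} (hl : ∀ i, Measurable (l i))
    {s : Fin n → Set Θ} (hs : ∀ i, MeasurableSet (s i)) :
    ∫⁻ θ in Set.univ.pi s, ∏ i, l i (θ i) ∂(Measure.pi fun _ => π) =
      ∏ i, ∫⁻ t in s i, l i t ∂π := by
  rw [← lintegral_indicator (MeasurableSet.univ_pi hs)]
  have h1 : ∀ θ : Fin n → Θ, (Set.univ.pi s).indicator (fun θ => ∏ i, l i (θ i)) θ =
      ∏ i, (s i).indicator (l i) (θ i) := by
    intro θ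
    by_cases h : θ ∈ Set.univ.pi s
    · rw [Set.indicator_of_mem h]
      exact Finset.prod_congr rfl fun i _ => (Set.indicator_of_mem (h i trivial) _).symm
    · rw [Set.indicator_of_notMem h]
      simp only [Set.mem_univ_pi, not_forall] at h
      obtain ⟨i, hi⟩ := h
      exact (Finset.prod_eq_zero (Finset.mem_univ i) (Set.indicator_of_notMem hi _)).symm
  simp_rw [h1]
  have h2 : iIndepFun (fun i (θ : Fin n → Θ) => (s i).indicator (l i) (θ i))
      (Measure.pi fun _ => π) :=
    iIndepFun_pi fun i => ((hl i).indicator (hs i)).aemeasurable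
  rw [lintegral_prod_eq_prod_lintegral_of_indepFun _ _ h2
    fun i => ((hl i).indicator (hs i)).comp (measurable_pi_apply i)]
  refine Finset.prod_congr rfl fun i _ => ?_
  rw [(measurePreserving_eval (fun _ => π) i).lintegral_comp ((hl i).indicator (hs i)),
    lintegral_indicator (hs i)]

theorem bayes_pi {n : ℕ} {Θ : Type*} [MeasurableSpace Θ] {π : Measure Θ}
    [IsProbabilityMeasure π] {l : Fin n → Θ → ℝ} (hl : ∀ i, Measurable (l i))
    (hl0 : ∀ i t, 0 ≤ l i t) [∀ i, IsProbabilityMeasure (bayes π (l i))] :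
    bayes (Measure.pi fun _ => π) (fun θ => ∏ i, l i (θ i)) =
      Measure.pi fun i => bayes π (l i) := by
  refine (Measure.pi_eq fun s hs => ?_).symm
  have hlm : ∀ i, Measurable fun t => ENNReal.ofReal (l i t) := fun i => by fun_prop
  -- A vanishing evidence would make `bayes` the zero measure, since `∞ * 0 = 0`. Positivity is
  -- needed to distribute the inverse over the product in `ℝ≥0∞`.
  have h0 : ∀ i, ∫⁻ t, ENNReal.ofReal (l i t) ∂π ≠ 0 := by
    intro i h
    have h1 := measure_univ (μ := bayes π (l i))
    rw [bayes, Measure.smul_apply, withDensity_apply _ MeasurableSet.univ, setLIntegral_univ,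
      h, smul_zero] at h1
    exact zero_ne_one h1
  have h2 : ∀ θ : Fin n → Θ, ENNReal.ofReal (∏ i, l i (θ i)) = ∏ i, ENNReal.ofReal (l i (θ i)) :=
    fun θ => ENNReal.ofReal_prod_of_nonneg fun i _ => hl0 i _
  have h3 := setLIntegral_univ_pi_prod (π := π) hlm (s := fun _ => Set.univ) fun _ => MeasurableSet.univ
  rw [Set.pi_univ] at h3
  simp only [setLIntegral_univ] at h3
  rw [bayes, Measure.smul_apply, withDensity_apply _ (MeasurableSet.univ_pi hs)]
  simp_rw [h2]
  rw [setLIntegral_univ_pi_prod hlm hs, h3, ENNReal.prod_inv_distrib (fun i _ j _ _ => Or.inl (h0 i)),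
    smul_eq_mul, ← Finset.prod_mul_distrib]
  refine Finset.prod_congr rfl fun i _ => ?_
  rw [bayes, Measure.smul_apply, withDensity_apply _ (hs i), smul_eq_mul]

theorem posterior_eq_pi {k n : ℕ} {S : Matrix (Fin k) (Fin k) ℝ} {d c : ℝ}
    [IsProbabilityMeasure (hyperPrior d c)] (hS : S.PosDef)
    (X : Fin n → EuclideanSpace ℝ (Fin k)) :
    posterior S d c X =
      Measure.pi fun i => bayes (priorOne S d c) fun t => gaussianDensity S t (X i) := by
  have := isProbabilityMeasure_priorOne (d := d) (c := c) hS
  have := fun i => isProbabilityMeasure_bayes_priorOne (d := d) (c := c) hS (X i)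
  exact bayes_pi (l := fun i t => gaussianDensity S t (X i))
    (fun i => measurable_gaussianDensity S (X i)) fun i t => gaussianDensity_nonneg t (X i)

/-- Markov's inequality for the posterior, with independent coordinates. -/
theorem missProb_le {k n : ℕ} {S : Matrix (Fin k) (Fin k) ℝ} {d c : ℝ}
    [IsProbabilityMeasure (hyperPrior d c)] (hS : S.PosDef)
    {N : EuclideanSpace ℝ (Fin k) → ℝ} (hN : Measurable N) (hN0 : ∀ x, 0 ≤ N x)
    {centre : (Fin n → EuclideanSpace ℝ (Fin k)) → Fin n → EuclideanSpace ℝ (Fin k)}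
    {G : Fin n → EuclideanSpace ℝ (Fin k) → ℝ≥0∞} (hG : ∀ i, Measurable (G i))
    (h : ∀ X i, ∫⁻ t, ENNReal.ofReal (N (t - centre X i))
      ∂(bayes (priorOne S d c) fun t => gaussianDensity S t (X i)) ≤ G i (X i))
    {r : ℝ} (hr : 0 < r) (θ₀ : Fin n → EuclideanSpace ℝ (Fin k)) :
    missProb S d c N centre r θ₀ ≤
      (∑ i, ∫⁻ z, G i (θ₀ i + sqrtCLM S z) ∂(stdGaussian (EuclideanSpace ℝ (Fin k)))) /
        ENNReal.ofReal r := by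
  have hX : ∀ X, posterior S d c X {θ | r < ∑ i, N (θ i - centre X i)} ≤
      (ENNReal.ofReal r)⁻¹ * ∑ i, G i (X i) := by
    intro X
    have := fun i => isProbabilityMeasure_bayes_priorOne (d := d) (c := c) hS (X i)
    rw [posterior_eq_pi hS]
    set P := fun i => bayes (priorOne S d c) fun t => gaussianDensity S t (X i)
    have hmeas : ∀ i, Measurable fun t => ENNReal.ofReal (N (t - centre X i)) :=
      fun i => by fun_prop
    calc _ ≤ Measure.pi P {θ | ENNReal.ofReal r ≤
            ∑ i, ENNReal.ofReal (N (θ i - centre X i))} := by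
          refine measure_mono fun θ hθ => ?_
          rw [Set.mem_ofPred_eq, ← ENNReal.ofReal_sum_of_nonneg fun _ _ => hN0 _]
          exact ENNReal.ofReal_le_ofReal (le_of_lt hθ)
      _ ≤ (∫⁻ θ, ∑ i, ENNReal.ofReal (N (θ i - centre X i)) ∂(Measure.pi P)) /
            ENNReal.ofReal r :=
          meas_ge_le_lintegral_div (Measurable.aemeasurable (Finset.measurable_fun_sum _ fun i _ =>
            (hmeas i).comp (measurable_pi_apply i))) (by simpa using hr) ENNReal.ofReal_ne_top
      _ ≤ _ := by
          rw [ENNReal.div_eq_inv_mul, lintegral_finsetSum _ fun i _ => by fun_prop]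
          gcongr with i
          rw [(measurePreserving_eval P i).lintegral_comp (hmeas i)]
          exact h X i
  rw [missProb, ENNReal.div_eq_inv_mul]
  -- Pointwise domination asks no measurability of the posterior probability in the data; only the
  -- `G i` must be measurable.
  refine (lintegral_mono hX).trans_eq ?_
  rw [lintegral_const_mul _ (by fun_prop), lintegral_finsetSum _ fun i _ => by fun_prop]
  congr 1
  refine Finset.sum_congr rfl fun i _ => ?_
  rw [dataLaw, (measurePreserving_eval (fun i => multivariateGaussian (θ₀ i) S) i).lintegral_comp
    (hG i), multivariateGaussian_eq_map_sqrtCLM, lintegral_map (hG i) (by fun_prop)]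

/-! ### Exponential tilts of a measure on the unit interval -/

section Tilt

/-- Mean of the exponential tilt of `μ` with parameter `s`. -/
noncomputable def tiltMean (μ : Measure ℝ) (s : ℝ) : ℝ := ∫ v, v ∂(μ.tilted fun v => s * v)

/-- Second moment of the exponential tilt of `μ` with parameter `s`. -/
noncomputable def tiltSq (μ : Measure ℝ) (s : ℝ) : ℝ := ∫ v, v ^ 2 ∂(μ.tilted fun v => s * v)

/-- Variance of the exponential tilt of `μ` with parameter `s`. -/
noncomputable def tiltVar (μ : Measure ℝ) (s : ℝ) : ℝ :=
  variance (fun v => v) (μ.tilted fun v => s * v)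

/-- Second moment about `1` of the exponential tilt of `μ` with parameter `s`. -/
noncomputable def tiltGap (μ : Measure ℝ) (s : ℝ) : ℝ :=
  ∫ v, (1 - v) ^ 2 ∂(μ.tilted fun v => s * v)

variable {μ : Measure ℝ} [IsFiniteMeasure μ] (hμ : ∀ᵐ v ∂μ, v ∈ Set.Icc (0 : ℝ) 1)

include hμ in
theorem mem_interior_integrableExpSet (s : ℝ) :
    s ∈ interior (integrableExpSet (fun v : ℝ => v) μ) := by
  have h : integrableExpSet (fun v : ℝ => v) μ = Set.univ :=
    Set.eq_univ_of_forall fun s => integrable_exp_mul_of_mem_Icc hμ s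
  rw [h, interior_univ]
  trivial

omit [IsFiniteMeasure μ] in
include hμ in
theorem ae_tilted (s : ℝ) : ∀ᵐ v ∂(μ.tilted fun v => s * v), v ∈ Set.Icc (0 : ℝ) 1 :=
  (tilted_absolutelyContinuous _ _).ae_le hμ

include hμ in
-- Mean and variance of the tilt are the first two derivatives of the cumulant generating function,
-- which is analytic everywhere because `μ` lives on `[0, 1]`.
theorem hasDerivAt_tiltMean (s : ℝ) : HasDerivAt (tiltMean μ) (tiltVar μ s) s := by
  have h1 : tiltMean μ = deriv (cgf (fun v => v) μ) := by
    ext s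
    exact integral_tilted_mul_self (mem_interior_integrableExpSet hμ s)
  have h2 : tiltVar μ s = deriv (deriv (cgf (fun v => v) μ)) s := by
    rw [tiltVar, variance_tilted_mul (mem_interior_integrableExpSet hμ s), iteratedDeriv_succ,
      iteratedDeriv_one]
  rw [h1, h2]
  exact (analyticAt_cgf (mem_interior_integrableExpSet hμ s)).deriv.differentiableAt.hasDerivAt

include hμ in
theorem measurable_tiltVar : Measurable (tiltVar μ) := by
  have h : tiltVar μ = deriv (tiltMean μ) := by
    ext s
    exact (hasDerivAt_tiltMean hμ s).deriv.symm
  rw [h]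
  exact measurable_deriv _

omit [IsFiniteMeasure μ] in
theorem tiltVar_nonneg (s : ℝ) : 0 ≤ tiltVar μ s := variance_nonneg _ _

omit [IsFiniteMeasure μ] in
theorem tiltSq_nonneg (s : ℝ) : 0 ≤ tiltSq μ s := integral_nonneg fun _ => sq_nonneg _

omit [IsFiniteMeasure μ] in
include hμ in
theorem tiltMean_nonneg (s : ℝ) : 0 ≤ tiltMean μ s :=
  integral_nonneg_of_ae (by filter_upwards [ae_tilted hμ s] with v hv using hv.1)

theorem measurable_integral_tilted (f : ℝ → ℝ) (hf : Measurable f) :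
    Measurable fun s => ∫ v, f v ∂(μ.tilted fun v => s * v) := by
  simp_rw [integral_tilted, smul_eq_mul, div_mul_eq_mul_div, integral_div]
  have h1 : StronglyMeasurable fun s => ∫ v, Real.exp (s * v) * f v ∂μ :=
    StronglyMeasurable.integral_prod_right' (f := fun q : ℝ × ℝ => Real.exp (q.1 * q.2) * f q.2)
      (Measurable.stronglyMeasurable (by fun_prop))
  have h2 : StronglyMeasurable fun s => ∫ v, Real.exp (s * v) ∂μ :=
    StronglyMeasurable.integral_prod_right' (f := fun q : ℝ × ℝ => Real.exp (q.1 * q.2))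
      (Measurable.stronglyMeasurable (by fun_prop))
  exact h1.measurable.div h2.measurable

variable [NeZero μ]

include hμ in
theorem isProbabilityMeasure_tilted_mul (s : ℝ) :
    IsProbabilityMeasure (μ.tilted fun v => s * v) :=
  isProbabilityMeasure_tilted (integrable_exp_mul_of_mem_Icc hμ s)

include hμ in
theorem integrable_tilted_of_bound (s : ℝ) {f : ℝ → ℝ} (hf : Measurable f) {C : ℝ}
    (h : ∀ v ∈ Set.Icc (0 : ℝ) 1, |f v| ≤ C) : Integrable f (μ.tilted fun v => s * v) := by
  have := isProbabilityMeasure_tilted_mul hμ s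
  refine Integrable.of_bound hf.aestronglyMeasurable C ?_
  filter_upwards [ae_tilted hμ s] with v hv using h v hv

include hμ in
theorem tiltMean_le_one (s : ℝ) : tiltMean μ s ≤ 1 := by
  have := isProbabilityMeasure_tilted_mul hμ s
  calc tiltMean μ s ≤ ∫ _, (1 : ℝ) ∂(μ.tilted fun v => s * v) := by
        refine integral_mono_ae ?_ (integrable_const _) ?_
        · exact integrable_tilted_of_bound hμ s measurable_id (C := 1)
            fun v hv => abs_le.2 ⟨by linarith [hv.1], hv.2⟩
        · filter_upwards [ae_tilted hμ s] with v hv using hv.2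
    _ = 1 := by simp

include hμ in
theorem tiltSq_le_tiltMean (s : ℝ) : tiltSq μ s ≤ tiltMean μ s := by
  refine integral_mono_ae ?_ ?_ ?_
  · exact integrable_tilted_of_bound hμ s (by fun_prop) (C := 1)
      fun v hv => abs_le.2 ⟨by nlinarith [hv.1], by nlinarith [hv.1, hv.2]⟩
  · exact integrable_tilted_of_bound hμ s measurable_id (C := 1)
      fun v hv => abs_le.2 ⟨by linarith [hv.1], hv.2⟩
  · filter_upwards [ae_tilted hμ s] with v hv
    nlinarith [hv.1, hv.2]

include hμ in
theorem tiltGap_le_one (s : ℝ) : tiltGap μ s ≤ 1 := by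
  have := isProbabilityMeasure_tilted_mul hμ s
  calc tiltGap μ s ≤ ∫ _, (1 : ℝ) ∂(μ.tilted fun v => s * v) := by
        refine integral_mono_ae ?_ (integrable_const _) ?_
        · exact integrable_tilted_of_bound hμ s (by fun_prop) (C := 1)
            fun v hv => abs_le.2 ⟨by nlinarith [hv.1, hv.2], by nlinarith [hv.1, hv.2]⟩
        · filter_upwards [ae_tilted hμ s] with v hv
          nlinarith [hv.1, hv.2]
    _ = 1 := by simp

include hμ in
theorem tiltVar_le_tiltSq (s : ℝ) : tiltVar μ s ≤ tiltSq μ s := by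
  have := isProbabilityMeasure_tilted_mul hμ s
  exact variance_le_expectation_sq (by fun_prop)

include hμ in
theorem tiltVar_le_tiltGap (s : ℝ) : tiltVar μ s ≤ tiltGap μ s := by
  have := isProbabilityMeasure_tilted_mul hμ s
  have h := variance_le_expectation_sq (μ := μ.tilted fun v => s * v)
    (X := fun v : ℝ => 1 - v) (by fun_prop)
  rwa [variance_const_sub (by fun_prop)] at h

include hμ in
/-- Since the variance of the tilt is the derivative of its mean, it has a bounded integral. -/
theorem lintegral_abs_mul_tiltVar_le (b : ℝ) :
    ∫⁻ t : ℝ, ENNReal.ofReal |t| * ENNReal.ofReal (tiltVar μ ((t ^ 2 + b) / 2)) ≤ 2 := by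
  -- The chain rule supplies the factor `t`, and `F` takes values in `[0, 1]`, so each half-line
  -- contributes at most `1`.
  set F : ℝ → ℝ := fun t => tiltMean μ ((t ^ 2 + b) / 2)
  have hF : ∀ t, HasDerivAt F (t * tiltVar μ ((t ^ 2 + b) / 2)) t := by
    intro t
    have h1 : HasDerivAt (fun t : ℝ => (t ^ 2 + b) / 2) t t := by
      have h2 : HasDerivAt (fun t : ℝ => (t ^ 2 + b) / 2) (((2 : ℕ) * t ^ (2 - 1)) / 2) t :=
        ((hasDerivAt_pow 2 t).add_const b).div_const 2
      convert! h2 using 1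
      simp
    rw [mul_comm]
    exact (hasDerivAt_tiltMean hμ _).comp t h1
  have hmono : Monotone (tiltMean μ) := by
    refine monotone_of_deriv_nonneg (fun s => (hasDerivAt_tiltMean hμ s).differentiableAt) ?_
    intro s
    rw [(hasDerivAt_tiltMean hμ s).deriv]
    exact tiltVar_nonneg s
  have hbdd : BddAbove (Set.range (tiltMean μ)) :=
    ⟨1, by rintro _ ⟨s, rfl⟩; exact tiltMean_le_one hμ s⟩
  have hlim : Tendsto F atTop (𝓝 (⨆ s, tiltMean μ s)) := by
    refine (tendsto_atTop_ciSup hmono hbdd).comp ?_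
    refine Tendsto.atTop_div_const two_pos ?_
    exact tendsto_atTop_add_const_right _ _ (tendsto_pow_atTop two_ne_zero)
  have hnn : ∀ t ∈ Set.Ioi (0 : ℝ), 0 ≤ t * tiltVar μ ((t ^ 2 + b) / 2) :=
    fun t ht => mul_nonneg (le_of_lt ht) (tiltVar_nonneg _)
  have hint := integrableOn_Ioi_deriv_of_nonneg' (fun t _ => hF t) hnn hlim
  have hval := integral_Ioi_of_hasDerivAt_of_nonneg' (fun t _ => hF t) hnn hlim
  set f : ℝ → ℝ≥0∞ :=
    fun t => ENNReal.ofReal |t| * ENNReal.ofReal (tiltVar μ ((t ^ 2 + b) / 2)) with hf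
  have hpos : ∫⁻ t in Set.Ioi 0, f t ≤ 1 := by
    have h1 : ∫⁻ t in Set.Ioi 0, f t =
        ∫⁻ t in Set.Ioi 0, ENNReal.ofReal (t * tiltVar μ ((t ^ 2 + b) / 2)) := by
      refine setLIntegral_congr_fun measurableSet_Ioi fun t ht => ?_
      rw [hf]
      simp only
      rw [abs_of_pos ht, ENNReal.ofReal_mul (le_of_lt ht)]
    rw [h1, ← ofReal_integral_eq_lintegral_ofReal hint
      ((ae_restrict_iff' measurableSet_Ioi).2 (Eventually.of_forall hnn)), hval,
      ENNReal.ofReal_le_one]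
    have h2 : ⨆ s, tiltMean μ s ≤ 1 := ciSup_le fun s => tiltMean_le_one hμ s
    have h3 : 0 ≤ F 0 := tiltMean_nonneg hμ _
    linarith
  have hneg : ∫⁻ t in Set.Iio 0, f t = ∫⁻ t in Set.Ioi 0, f t := by
    have h1 := (Measure.measurePreserving_neg (volume : Measure ℝ)).setLIntegral_comp_preimage_emb
      (MeasurableEquiv.neg ℝ).measurableEmbedding f (Set.Ioi 0)
    rw [← h1]
    simp [hf]
  calc ∫⁻ t, f t = (∫⁻ t in Set.Iio 0, f t) + ∫⁻ t in Set.Ici 0, f t := by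
        rw [← Set.compl_Iio, lintegral_add_compl _ measurableSet_Iio]
    _ = (∫⁻ t in Set.Ioi 0, f t) + ∫⁻ t in Set.Ioi 0, f t := by
        rw [hneg, Measure.restrict_congr_set Ioi_ae_eq_Ici]
    _ ≤ 1 + 1 := add_le_add hpos hpos
    _ = 2 := one_add_one_eq_two

/-- For `x ≤ A` the first term suffices; beyond `A`, half of the exponential absorbs `x²` and the
other half is at most `exp (-A / 2)`. -/
theorem sq_mul_exp_neg_le {A x : ℝ} (hx : 0 ≤ x) :
    x ^ 2 * Real.exp (-x) ≤ A ^ 2 * Real.exp (-x) + 16 * Real.exp (-A / 2) := by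
  rcases le_total x A with h | h
  · have : x ^ 2 * Real.exp (-x) ≤ A ^ 2 * Real.exp (-x) := by gcongr
    have : 0 < Real.exp (-A / 2) := Real.exp_pos _
    linarith
  · have h1 : x / 4 ≤ Real.exp (x / 4) := by linarith [Real.add_one_le_exp (x / 4)]
    have h2 : x ^ 2 ≤ 16 * Real.exp (x / 2) := by
      have h3 : (x / 4) ^ 2 ≤ Real.exp (x / 4) ^ 2 := by gcongr
      rw [← Real.exp_nat_mul] at h3
      have h4 : ((2 : ℕ) : ℝ) * (x / 4) = x / 2 := by push_cast; ring
      rw [h4] at h3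
      linarith
    have h5 : x ^ 2 * Real.exp (-x) ≤ 16 * Real.exp (-A / 2) := by
      calc x ^ 2 * Real.exp (-x) ≤ 16 * Real.exp (x / 2) * Real.exp (-x) := by gcongr
        _ = 16 * Real.exp (-x / 2) := by
          rw [mul_assoc, ← Real.exp_add]
          congr 2
          ring
        _ ≤ 16 * Real.exp (-A / 2) := by gcongr
    have : 0 ≤ A ^ 2 * Real.exp (-x) := by positivity
    linarith

include hμ in
-- Take `x = s (1 - v)` and `A = 2 a` in `sq_mul_exp_neg_le`, where `a = s - log m` and `m` is the
-- normaliser of the tilt. Then `exp (-A / 2) * exp s = m`, so after division by `m` the remainder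
-- is at most `16`, the mass of `μ` being at most `1`.
theorem sq_mul_tiltGap_le (h1 : μ Set.univ ≤ 1) {s : ℝ} (hs : 0 ≤ s) :
    s ^ 2 * tiltGap μ s ≤ 4 * (s - Real.log (∫ v, Real.exp (s * v) ∂μ)) ^ 2 + 16 := by
  have hint := integrable_exp_mul_of_mem_Icc hμ s
  have hm : 0 < ∫ v, Real.exp (s * v) ∂μ := integral_exp_pos hint
  set m := ∫ v, Real.exp (s * v) ∂μ with hmdef
  set a := s - Real.log m with ha
  have hreal : μ.real Set.univ ≤ 1 := ENNReal.toReal_le_of_le_ofReal zero_le_one (by simpa using h1)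
  have hexp : Real.exp (-(2 * a) / 2) * Real.exp s = m := by
    rw [← Real.exp_add, ha, show -(2 * (s - Real.log m)) / 2 + s = Real.log m by ring,
      Real.exp_log hm]
  have hpt : ∀ v ∈ Set.Icc (0 : ℝ) 1, s ^ 2 * ((1 - v) ^ 2 * Real.exp (s * v)) ≤
      4 * a ^ 2 * Real.exp (s * v) + 16 * m := by
    intro v hv
    have h2 := sq_mul_exp_neg_le (A := 2 * a) (x := s * (1 - v))
      (mul_nonneg hs (by linarith [hv.2]))
    have h3 : Real.exp (-(s * (1 - v))) * Real.exp s = Real.exp (s * v) := by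
      rw [← Real.exp_add]; congr 1; ring
    have h4 := mul_le_mul_of_nonneg_right h2 (Real.exp_pos s).le
    calc s ^ 2 * ((1 - v) ^ 2 * Real.exp (s * v))
        = (s * (1 - v)) ^ 2 * Real.exp (-(s * (1 - v))) * Real.exp s := by rw [← h3]; ring
      _ ≤ _ := h4
      _ = (2 * a) ^ 2 * (Real.exp (-(s * (1 - v))) * Real.exp s) +
          16 * (Real.exp (-(2 * a) / 2) * Real.exp s) := by ring
      _ = _ := by rw [h3, hexp]; ring
  have hG : tiltGap μ s = (∫ v, (1 - v) ^ 2 * Real.exp (s * v) ∂μ) / m := by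
    rw [tiltGap, integral_tilted, ← integral_div]
    refine integral_congr_ae (Eventually.of_forall fun v => ?_)
    simp only [smul_eq_mul]
    ring
  have hint2 : Integrable (fun v => (1 - v) ^ 2 * Real.exp (s * v)) μ := by
    refine hint.mono (by fun_prop) ?_
    filter_upwards [hμ] with v hv
    rw [Real.norm_eq_abs, Real.norm_eq_abs, abs_of_nonneg (by positivity),
      abs_of_nonneg (by positivity)]
    have : (1 - v) ^ 2 ≤ 1 := by nlinarith [hv.1, hv.2]
    nlinarith [Real.exp_pos (s * v)]
  have hI : s ^ 2 * ∫ v, (1 - v) ^ 2 * Real.exp (s * v) ∂μ ≤ (4 * a ^ 2 + 16) * m := by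
    rw [← integral_const_mul]
    calc _ ≤ ∫ v, (4 * a ^ 2 * Real.exp (s * v) + 16 * m) ∂μ := by
          refine integral_mono_ae (hint2.const_mul _)
            ((hint.const_mul _).add (integrable_const _)) ?_
          filter_upwards [hμ] with v hv using hpt v hv
      _ = 4 * a ^ 2 * m + μ.real Set.univ * (16 * m) := by
          rw [integral_add (hint.const_mul _) (integrable_const _), integral_const_mul]
          simp [m]
      _ ≤ 4 * a ^ 2 * m + 1 * (16 * m) := by gcongr
      _ = _ := by ring
  rw [hG, mul_div_assoc', div_le_iff₀ hm]
  exact hI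

end Tilt

/-! ### Gaussian integrals of radial functions -/

/-- The density is at most `1 / √(2π) ≤ 1 / 2` and Lebesgue measure is translation invariant, so the
bound does not see the mean `m`. -/
theorem lintegral_gaussianReal_le (f : ℝ → ℝ≥0∞) (hf : Measurable f) (m : ℝ) :
    ∫⁻ t, f (m + t) ∂(gaussianReal 0 1) ≤ ENNReal.ofReal (1 / 2) * ∫⁻ t, f t := by
  have h : ∀ t, gaussianPDF 0 1 t ≤ ENNReal.ofReal (1 / 2) := by
    intro t
    refine ENNReal.ofReal_le_ofReal ?_
    rw [gaussianPDFReal]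
    have h1 : (2 : ℝ) ≤ √(2 * Real.pi * ((1 : NNReal) : ℝ)) := by
      refine Real.le_sqrt_of_sq_le ?_
      push_cast
      nlinarith [Real.pi_gt_three]
    have h2 : Real.exp (-(t - 0) ^ 2 / (2 * ((1 : NNReal) : ℝ))) ≤ 1 := by
      rw [Real.exp_le_one_iff]
      push_cast
      nlinarith [sq_nonneg (t - 0)]
    calc _ ≤ (2 : ℝ)⁻¹ * 1 := by gcongr
      _ = 1 / 2 := by norm_num
  rw [gaussianReal_of_var_ne_zero _ one_ne_zero,
    lintegral_withDensity_eq_lintegral_mul _ (measurable_gaussianPDF 0 1) (by fun_prop)]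
  calc _ ≤ ∫⁻ t, ENNReal.ofReal (1 / 2) * f (m + t) := by
        refine lintegral_mono fun t => ?_
        simp only [Pi.mul_apply]
        gcongr
        exact h t
    _ = _ := by
        rw [lintegral_const_mul _ (by fun_prop), lintegral_add_left_eq_self f m]

/-- Fubini: freeze the coordinates other than `j`; their squares sum to the `b` of the hypothesis,
which holds for all `b`. -/
theorem lintegral_abs_coord_mul_radial_le {k : ℕ} {h : ℝ → ℝ≥0∞} (hm : Measurable h)
    (hh : ∀ b, ∫⁻ t : ℝ, ENNReal.ofReal |t| * h ((t ^ 2 + b) / 2) ≤ 2)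
    (η : EuclideanSpace ℝ (Fin k)) (j : Fin k) :
    ∫⁻ z, ENNReal.ofReal |(η + z) j| * h (‖η + z‖ ^ 2 / 2)
      ∂(stdGaussian (EuclideanSpace ℝ (Fin k))) ≤ 1 := by
  obtain _ | k := k
  · exact j.elim0
  rw [← map_pi_eq_stdGaussian, lintegral_map (by fun_prop) (by fun_prop)]
  have hmp := (measurePreserving_piFinSuccAbove (fun _ : Fin (k + 1) => gaussianReal 0 1) j).symm
  rw [← hmp.lintegral_comp (by fun_prop), lintegral_prod_symm _
    (Measurable.aemeasurable (by fun_prop))]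
  calc _ ≤ ∫⁻ _ : Fin k → ℝ, 1 ∂(Measure.pi fun _ => gaussianReal 0 1) := by
        refine lintegral_mono fun r => ?_
        have h1 : ∀ t : ℝ, ‖η + WithLp.toLp 2
            ((MeasurableEquiv.piFinSuccAbove (fun _ => ℝ) j).symm (t, r))‖ ^ 2 =
              (η j + t) ^ 2 + ∑ i, (η (j.succAbove i) + r i) ^ 2 := by
          intro t
          rw [EuclideanSpace.real_norm_sq_eq, Fin.sum_univ_succAbove _ j]
          simp
        have h2 : ∀ t : ℝ, (η + WithLp.toLp 2
            ((MeasurableEquiv.piFinSuccAbove (fun _ => ℝ) j).symm (t, r))) j = η j + t := by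
          intro t
          simp
        simp only [h1, h2]
        refine (lintegral_gaussianReal_le (fun t => ENNReal.ofReal |t| *
          h ((t ^ 2 + ∑ i, (η (j.succAbove i) + r i) ^ 2) / 2)) (by fun_prop) (η j)).trans ?_
        calc _ ≤ ENNReal.ofReal (1 / 2) * 2 := by gcongr; exact hh _
          _ = 1 := by
            rw [show (2 : ℝ≥0∞) = ENNReal.ofReal 2 by simp, ← ENNReal.ofReal_mul (by norm_num)]
            norm_num
    _ = 1 := by simp

/-! ### Posterior second moments of one mean -/

section Risk

variable {k : ℕ} {S : Matrix (Fin k) (Fin k) ℝ} {d c : ℝ} [IsProbabilityMeasure (hyperPrior d c)]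

theorem lintegral_bayes_le (hS : S.PosDef) {N : EuclideanSpace ℝ (Fin k) → ℝ}
    (hNm : Measurable N) {C : ℝ} (hC0 : 0 ≤ C) (hC : ∀ z, N (sqrtCLM S z) ≤ C * ‖z‖ ^ 2)
    (y b : EuclideanSpace ℝ (Fin k)) {f : ℝ → ℝ} (hf : Measurable f) (hf0 : ∀ v, 0 ≤ f v)
    {B : ℝ} (hfB : ∀ v ∈ Set.Icc (0 : ℝ) 1, f v ≤ B)
    (h : ∀ v ∈ Set.Icc (0 : ℝ) 1, ∀ w, ‖v • y + √v • w - b‖ ^ 2 ≤ 3 * (f v + v * ‖w‖ ^ 2)) :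
    ∫⁻ t, ENNReal.ofReal (N (t - sqrtCLM S b))
      ∂(bayes (priorOne S d c) fun t => gaussianDensity S t (sqrtCLM S y)) ≤
    ENNReal.ofReal (3 * C * (∫ v, f v ∂((mixing k d c).tilted fun v => ‖y‖ ^ 2 / 2 * v) +
      k * tiltMean (mixing k d c) (‖y‖ ^ 2 / 2))) := by
  set ρ := (mixing k d c).tilted fun v => ‖y‖ ^ 2 / 2 * v with hρdef
  have hae : ∀ᵐ v ∂ρ, v ∈ Set.Icc (0 : ℝ) 1 := ae_tilted (ae_mixing k d c) _
  have hi1 : Integrable f ρ := integrable_tilted_of_bound (ae_mixing k d c) _ hf (C := B)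
    fun v hv => by rw [abs_of_nonneg (hf0 v)]; exact hfB v hv
  have hi2 : Integrable (fun v => v) ρ :=
    integrable_tilted_of_bound (ae_mixing k d c) _ measurable_id (C := 1)
      fun v hv => abs_le.2 ⟨by linarith [hv.1], hv.2⟩
  rw [bayes_priorOne hS, lintegral_map (by fun_prop) (by fun_prop),
    lintegral_prod _ (Measurable.aemeasurable (by fun_prop))]
  calc _ ≤ ∫⁻ v, ENNReal.ofReal (3 * C * (f v + k * v)) ∂ρ := by
        refine lintegral_mono_ae ?_
        filter_upwards [hae] with v hv
        calc _ ≤ ∫⁻ w : EuclideanSpace ℝ (Fin k), (ENNReal.ofReal (3 * C * f v) +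
                ENNReal.ofReal (3 * C * v) * ENNReal.ofReal (‖w‖ ^ 2)) ∂(stdGaussian _) := by
              refine lintegral_mono fun w => ?_
              have hfv := hf0 v
              have hv0 := hv.1
              rw [← ENNReal.ofReal_mul (by positivity), ← ENNReal.ofReal_add (by positivity)
                (by positivity), ← map_sub]
              refine ENNReal.ofReal_le_ofReal ((hC _).trans ?_)
              calc C * _ ≤ C * (3 * (f v + v * ‖w‖ ^ 2)) := by gcongr; exact h v hv w
                _ = _ := by ring
          _ = _ := by
              have hfv := hf0 v
              have hv0 := hv.1
              rw [lintegral_add_left measurable_const, lintegral_const,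
                lintegral_const_mul _ (by fun_prop), lintegral_norm_sq_stdGaussian, measure_univ,
                mul_one, finrank_euclideanSpace_fin, ← ENNReal.ofReal_mul (by positivity),
                ← ENNReal.ofReal_add (by positivity) (by positivity)]
              congr 1
              ring
    _ = _ := by
        rw [← ofReal_integral_eq_lintegral_ofReal, integral_const_mul,
          integral_add hi1 (hi2.const_mul _), integral_const_mul]
        · rfl
        · exact (hi1.add (hi2.const_mul _)).const_mul _
        · filter_upwards [hae] with v hv
          have hfv := hf0 v
          have hv0 := hv.1
          simp only [Pi.zero_apply]
          positivity

/-- The constant `3` in place of `2` lets two-term and three-term splittings share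
`lintegral_bayes_le`. -/
theorem norm_add_sq_le_three {E : Type*} [NormedAddCommGroup E] (a b : E) :
    ‖a + b‖ ^ 2 ≤ 3 * (‖a‖ ^ 2 + ‖b‖ ^ 2) := by
  have h := norm_add_le a b
  have h0 := norm_nonneg (a + b)
  have h1 : ‖a + b‖ ^ 2 ≤ (‖a‖ + ‖b‖) ^ 2 := by gcongr
  nlinarith [sq_nonneg (‖a‖ - ‖b‖), sq_nonneg ‖a‖, sq_nonneg ‖b‖]

theorem norm_add_add_sq_le {E : Type*} [NormedAddCommGroup E] (a b e : E) :
    ‖a + b + e‖ ^ 2 ≤ 3 * (‖a‖ ^ 2 + ‖b‖ ^ 2 + ‖e‖ ^ 2) := by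
  have h := norm_add₃_le (a := a) (b := b) (c := e)
  have h1 : ‖a + b + e‖ ^ 2 ≤ (‖a‖ + ‖b‖ + ‖e‖) ^ 2 := by gcongr
  nlinarith [sq_nonneg (‖a‖ - ‖b‖), sq_nonneg (‖a‖ - ‖e‖), sq_nonneg (‖b‖ - ‖e‖)]

theorem norm_sqrt_smul_sq {E : Type*} [NormedAddCommGroup E] [NormedSpace ℝ E] {v : ℝ}
    (hv : 0 ≤ v) (w : E) : ‖√v • w‖ ^ 2 = v * ‖w‖ ^ 2 := by
  rw [norm_smul, mul_pow, Real.norm_eq_abs, sq_abs, Real.sq_sqrt hv]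

theorem norm_smul_sq {E : Type*} [NormedAddCommGroup E] [NormedSpace ℝ E] (a : ℝ) (w : E) :
    ‖a • w‖ ^ 2 = a ^ 2 * ‖w‖ ^ 2 := by
  rw [norm_smul, mul_pow, Real.norm_eq_abs, sq_abs]

variable (hS : S.PosDef) {N : EuclideanSpace ℝ (Fin k) → ℝ} (hNm : Measurable N) {C : ℝ}
  (hC0 : 0 ≤ C) (hC : ∀ z, N (sqrtCLM S z) ≤ C * ‖z‖ ^ 2)

include hS hNm hC0 hC

theorem lintegral_bayes_sub_estimator_le (y : EuclideanSpace ℝ (Fin k)) :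
    ∫⁻ t, ENNReal.ofReal (N (t - estimator S d c (sqrtCLM S y)))
      ∂(bayes (priorOne S d c) fun t => gaussianDensity S t (sqrtCLM S y)) ≤
    ENNReal.ofReal (3 * C * (‖y‖ ^ 2 * tiltVar (mixing k d c) (‖y‖ ^ 2 / 2) +
      k * tiltMean (mixing k d c) (‖y‖ ^ 2 / 2))) := by
  rw [estimator_sqrtCLM hS]
  set m := ∫ v, v ∂((mixing k d c).tilted fun v => ‖y‖ ^ 2 / 2 * v)
  refine (lintegral_bayes_le hS hNm hC0 hC y (m • y) (f := fun v => ‖y‖ ^ 2 * (v - m) ^ 2)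
    (by fun_prop) (fun v => by positivity) (B := ‖y‖ ^ 2 * (1 + |m|) ^ 2) ?_ ?_).trans_eq ?_
  · intro v hv
    have h1 : |v - m| ≤ 1 + |m| :=
      (abs_sub v m).trans (add_le_add (abs_le.2 ⟨by linarith [hv.1], hv.2⟩) le_rfl)
    have h2 : (v - m) ^ 2 ≤ (1 + |m|) ^ 2 := by rw [← sq_abs (v - m)]; gcongr
    gcongr
  · intro v hv w
    have h1 : v • y + √v • w - m • y = (v - m) • y + √v • w := by rw [sub_smul]; abel
    rw [h1]
    refine (norm_add_sq_le_three _ _).trans_eq ?_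
    rw [norm_sqrt_smul_sq hv.1, norm_smul_sq]
    ring
  · rw [integral_const_mul]
    have := variance_eq_integral (μ := (mixing k d c).tilted fun v => ‖y‖ ^ 2 / 2 * v)
      (X := fun v => v) (by fun_prop)
    rw [tiltVar, this]

theorem lintegral_bayes_sub_le (y η : EuclideanSpace ℝ (Fin k)) :
    ∫⁻ t, ENNReal.ofReal (N (t - sqrtCLM S η))
      ∂(bayes (priorOne S d c) fun t => gaussianDensity S t (sqrtCLM S y)) ≤
    ENNReal.ofReal (3 * C * (‖y‖ ^ 2 * tiltGap (mixing k d c) (‖y‖ ^ 2 / 2) + ‖y - η‖ ^ 2 +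
      k * tiltMean (mixing k d c) (‖y‖ ^ 2 / 2))) := by
  have hp := isProbabilityMeasure_tilted_mul (ae_mixing k d c) (‖y‖ ^ 2 / 2)
  refine (lintegral_bayes_le hS hNm hC0 hC y η
    (f := fun v => ‖y‖ ^ 2 * (1 - v) ^ 2 + ‖y - η‖ ^ 2)
    (by fun_prop) (fun v => by positivity) (B := ‖y‖ ^ 2 * 1 + ‖y - η‖ ^ 2) ?_ ?_).trans_eq ?_
  · intro v hv
    have : (1 - v) ^ 2 ≤ 1 := by nlinarith [hv.1, hv.2]
    gcongr
  · intro v hv w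
    have h1 : v • y + √v • w - η = -((1 - v) • y) + (y - η) + √v • w := by
      rw [sub_smul, one_smul]; abel
    rw [h1]
    refine (norm_add_add_sq_le _ _ _).trans_eq ?_
    rw [norm_sqrt_smul_sq hv.1, norm_neg, norm_smul_sq]
    ring
  · rw [integral_add _ (integrable_const _), integral_const_mul]
    · simp [tiltGap]
    · exact (integrable_tilted_of_bound (ae_mixing k d c) _ (by fun_prop) (C := 1)
        fun v hv => abs_le.2
          ⟨by nlinarith [hv.1, hv.2], by nlinarith [hv.1, hv.2]⟩).const_mul _

theorem lintegral_bayes_le_tiltSq (y : EuclideanSpace ℝ (Fin k)) :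
    ∫⁻ t, ENNReal.ofReal (N (t - 0))
      ∂(bayes (priorOne S d c) fun t => gaussianDensity S t (sqrtCLM S y)) ≤
    ENNReal.ofReal (3 * C * (‖y‖ ^ 2 * tiltSq (mixing k d c) (‖y‖ ^ 2 / 2) +
      k * tiltMean (mixing k d c) (‖y‖ ^ 2 / 2))) := by
  have h := lintegral_bayes_le (d := d) (c := c) hS hNm hC0 hC y 0
    (f := fun v => ‖y‖ ^ 2 * v ^ 2)
    (by fun_prop) (fun v => by positivity) (B := ‖y‖ ^ 2 * 1) ?_ ?_
  · rw [integral_const_mul, map_zero] at h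
    exact h
  · intro v hv
    have : v ^ 2 ≤ 1 := by nlinarith [hv.1, hv.2]
    gcongr
  · intro v hv w
    rw [sub_zero]
    refine (norm_add_sq_le_three _ _).trans_eq ?_
    rw [norm_sqrt_smul_sq hv.1, norm_smul_sq]
    ring

end Risk

/-! ### Expectations under the sampling model -/

section Sampling

variable {k : ℕ} {μ : Measure ℝ} [IsFiniteMeasure μ] [NeZero μ]
  (hμ : ∀ᵐ v ∂μ, v ∈ Set.Icc (0 : ℝ) 1) {K L : ℝ}
  (hgap : ∀ s, 1 ≤ s → 2 * s * tiltGap μ s ≤ K * (1 + L ^ 2 / s))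

include hμ hgap

/-- Split at `s = L`: below it the gap is at most `1`, above it `L² / s ≤ L`. -/
theorem norm_sq_mul_tiltGap_le (hK : 0 ≤ K) (hL : 1 ≤ L) {E : Type*} [NormedAddCommGroup E]
    (y : E) : ‖y‖ ^ 2 * tiltGap μ (‖y‖ ^ 2 / 2) ≤ (2 + 2 * K) * L := by
  set s := ‖y‖ ^ 2 / 2 with hs
  have h2 : ‖y‖ ^ 2 = 2 * s := by rw [hs]; ring
  have hs0 : 0 ≤ s := by positivity
  rw [h2]
  have hKL : 0 ≤ K * L := by positivity
  rcases le_total s L with h | h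
  · have := mul_le_mul_of_nonneg_left (tiltGap_le_one hμ s) (by positivity : 0 ≤ 2 * s)
    linarith
  · refine (hgap s (hL.trans h)).trans ?_
    have : L ^ 2 / s ≤ L := by
      rw [div_le_iff₀ (by linarith)]
      nlinarith
    calc K * (1 + L ^ 2 / s) ≤ K * (L + L) := by gcongr
      _ ≤ (2 + 2 * K) * L := by nlinarith

/-- Split at `‖y‖ = r`. Inside, `‖y‖² ≤ r ∑ j, |y j|`, and each coordinate integral is at most `1`
uniformly in `η`. Outside, the variance is at most the gap; `r ≥ 2` guarantees `s ≥ 1` there. -/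
theorem lintegral_norm_sq_mul_tiltVar_le (hK : 0 ≤ K) {r : ℝ} (hr : 2 ≤ r)
    (η : EuclideanSpace ℝ (Fin k)) :
    ∫⁻ z, ENNReal.ofReal (‖η + z‖ ^ 2 * tiltVar μ (‖η + z‖ ^ 2 / 2))
      ∂(stdGaussian (EuclideanSpace ℝ (Fin k))) ≤
    ENNReal.ofReal (k * r + K * (1 + 2 * L ^ 2 / r ^ 2)) := by
  have hr0 : 0 < r := by linarith
  have hV := measurable_tiltVar hμ
  have hpt : ∀ y : EuclideanSpace ℝ (Fin k),
      ENNReal.ofReal (‖y‖ ^ 2 * tiltVar μ (‖y‖ ^ 2 / 2)) ≤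
        ∑ j, ENNReal.ofReal r *
          (ENNReal.ofReal |y j| * ENNReal.ofReal (tiltVar μ (‖y‖ ^ 2 / 2))) +
        ENNReal.ofReal (K * (1 + 2 * L ^ 2 / r ^ 2)) := by
    intro y
    have hV0 := tiltVar_nonneg (μ := μ) (‖y‖ ^ 2 / 2)
    rcases le_total ‖y‖ r with h | h
    · refine le_add_right ?_
      simp_rw [← ENNReal.ofReal_mul (abs_nonneg _), ← ENNReal.ofReal_mul hr0.le]
      rw [← ENNReal.ofReal_sum_of_nonneg fun _ _ => by positivity]
      refine ENNReal.ofReal_le_ofReal ?_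
      nth_rewrite 1 [EuclideanSpace.real_norm_sq_eq]
      rw [Finset.sum_mul]
      refine Finset.sum_le_sum fun j _ => ?_
      rw [← mul_assoc]
      gcongr
      have h1 : |y j| ≤ r := (PiLp.norm_apply_le y j).trans h
      rw [← sq_abs, sq]
      gcongr
    · refine le_add_left (ENNReal.ofReal_le_ofReal ?_)
      have hs : 1 ≤ ‖y‖ ^ 2 / 2 := by nlinarith
      calc ‖y‖ ^ 2 * tiltVar μ (‖y‖ ^ 2 / 2)
          ≤ ‖y‖ ^ 2 * tiltGap μ (‖y‖ ^ 2 / 2) := by gcongr; exact tiltVar_le_tiltGap hμ _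
        _ = 2 * (‖y‖ ^ 2 / 2) * tiltGap μ (‖y‖ ^ 2 / 2) := by ring
        _ ≤ K * (1 + L ^ 2 / (‖y‖ ^ 2 / 2)) := hgap _ hs
        _ = K * (1 + 2 * L ^ 2 / ‖y‖ ^ 2) := by rw [div_div_eq_mul_div, mul_comm (L ^ 2) 2]
        _ ≤ K * (1 + 2 * L ^ 2 / r ^ 2) := by gcongr
  have hcoord : ∀ j : Fin k, ∫⁻ z, ENNReal.ofReal r * (ENNReal.ofReal |(η + z) j| *
      ENNReal.ofReal (tiltVar μ (‖η + z‖ ^ 2 / 2))) ∂(stdGaussian (EuclideanSpace ℝ (Fin k))) ≤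
        ENNReal.ofReal r := by
    intro j
    rw [lintegral_const_mul _ (by fun_prop)]
    refine mul_le_of_le_one_right' ?_
    exact lintegral_abs_coord_mul_radial_le (h := fun s => ENNReal.ofReal (tiltVar μ s))
      (by fun_prop) (lintegral_abs_mul_tiltVar_le hμ) η j
  refine (lintegral_mono fun z => hpt (η + z)).trans ?_
  rw [lintegral_add_right _ measurable_const, lintegral_const, measure_univ, mul_one,
    lintegral_finsetSum _ fun j _ => by fun_prop,
    ENNReal.ofReal_add (by positivity) (by positivity)]
  gcongr
  refine (Finset.sum_le_sum fun j _ => hcoord j).trans_eq ?_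
  rw [Finset.sum_const, Finset.card_univ, Fintype.card_fin, ENNReal.ofReal_mul (by positivity),
    nsmul_eq_mul, ENNReal.ofReal_natCast]

end Sampling

section Null

variable {k : ℕ} {d c : ℝ} [IsProbabilityMeasure (hyperPrior d c)]

/-- The prior predictive expectation controls posterior expectations at `0`. -/
theorem lintegral_tiltMean_le {b e : ℝ} (hb : 0 < b)
    (hbm : ENNReal.ofReal b ≤ mixing k d c Set.univ)
    (he : ∫⁻ p, ENNReal.ofReal (shrink p) ∂(hyperPrior d c) ≤ ENNReal.ofReal e) :
    ∫⁻ z, ENNReal.ofReal (tiltMean (mixing k d c) (‖z‖ ^ 2 / 2))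
      ∂(stdGaussian (EuclideanSpace ℝ (Fin k))) ≤ ENNReal.ofReal (e / b) := by
  have hms := measurable_shrink
  have hμ := ae_mixing k d c
  have hpt : ∀ z : EuclideanSpace ℝ (Fin k),
      ENNReal.ofReal (tiltMean (mixing k d c) (‖z‖ ^ 2 / 2)) ≤
        ∫⁻ p, ENNReal.ofReal (shrink p / b) * (ENNReal.ofReal (√(1 - shrink p) ^ k) *
          ENNReal.ofReal (Real.exp (shrink p * ‖z‖ ^ 2 / 2))) ∂(hyperPrior d c) := by
    intro z
    set s := ‖z‖ ^ 2 / 2 with hs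
    have hs0 : 0 ≤ s := by positivity
    have hint := integrable_exp_mul_of_mem_Icc hμ s
    -- The normaliser of the tilt is at least the mass of `mixing`, as `exp (s v) ≥ 1`.
    have hbI : b ≤ ∫ v, Real.exp (s * v) ∂(mixing k d c) := by
      have h1 : b ≤ (mixing k d c).real Set.univ :=
        (ENNReal.ofReal_le_iff_le_toReal (measure_ne_top _ _)).1 hbm
      calc b ≤ ∫ _, (1 : ℝ) ∂(mixing k d c) := by simpa using h1
        _ ≤ _ := by
          refine integral_mono_ae (integrable_const _) hint ?_
          filter_upwards [hμ] with v hv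
          exact Real.one_le_exp (mul_nonneg hs0 hv.1)
    rw [tiltMean, ofReal_integral_eq_lintegral_ofReal
      (integrable_tilted_of_bound hμ _ (f := fun v => v) measurable_id (C := 1)
        fun v hv => abs_le.2 ⟨by linarith [hv.1], hv.2⟩)
      (by filter_upwards [ae_tilted hμ s] with v hv using hv.1), lintegral_tilted,
      lintegral_mixing _ _ _ (by fun_prop)]
    refine lintegral_mono fun p => ?_
    have h0 := shrink_nonneg p
    rw [mul_left_comm (ENNReal.ofReal (shrink p / b))]
    refine mul_le_mul' le_rfl ?_
    rw [← ENNReal.ofReal_mul (by positivity), ← ENNReal.ofReal_mul (by positivity)]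
    refine ENNReal.ofReal_le_ofReal ?_
    have h2 : s * shrink p = shrink p * ‖z‖ ^ 2 / 2 := by rw [hs]; ring
    calc _ ≤ Real.exp (s * shrink p) / b * shrink p := by gcongr
      _ = _ := by rw [h2]; ring
  refine (lintegral_mono hpt).trans ?_
  -- With the Gaussian integral innermost, `exp (v ‖z‖² / 2)` integrates to `(1 - v) ^ (-k / 2)` and
  -- cancels the weight exactly, leaving the prior mean of `v` over `b`.
  rw [lintegral_lintegral_swap (Measurable.aemeasurable (by fun_prop))]
  calc _ = ∫⁻ p, ENNReal.ofReal b⁻¹ * ENNReal.ofReal (shrink p) ∂(hyperPrior d c) := by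
        refine lintegral_congr fun p => ?_
        have h0 := shrink_nonneg p
        have h1 : 0 < √(1 - shrink p) := Real.sqrt_pos.2 (by linarith [shrink_lt_one p])
        rw [lintegral_const_mul _ (by fun_prop), lintegral_const_mul _ (by fun_prop),
          lintegral_exp_mul_norm_sq_stdGaussian (shrink_lt_one p), finrank_euclideanSpace_fin,
          ← ENNReal.ofReal_mul (by positivity), ← mul_pow, mul_one_div_cancel h1.ne', one_pow,
          ENNReal.ofReal_one, mul_one, ← ENNReal.ofReal_mul (by positivity)]
        congr 1
        ring
    _ ≤ ENNReal.ofReal b⁻¹ * ENNReal.ofReal e := by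
        rw [lintegral_const_mul _ (by fun_prop)]
        gcongr
    _ = _ := by
        rw [← ENNReal.ofReal_mul (by positivity)]
        congr 1
        ring

/-- A bound on the Gaussian tail of `‖z‖ ^ 2 + k`. -/
noncomputable def tailConst (k : ℕ) : ℝ := (16 + k) * (1 / √(1 - 7 / 8)) ^ k

theorem tailConst_nonneg (k : ℕ) : 0 ≤ tailConst k := by
  unfold tailConst
  positivity

/-- Split at `‖z‖² = 4 L`: inside, `v² ≤ v` reduces everything to the posterior mean of `v`;
outside, moments of `v` are bounded by `1` and the Gaussian tail decides. -/
theorem lintegral_null_le {b e L : ℝ} (hb : 0 < b) (hL : 0 ≤ L) (he0 : 0 ≤ e)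
    (hbm : ENNReal.ofReal b ≤ mixing k d c Set.univ)
    (he : ∫⁻ p, ENNReal.ofReal (shrink p) ∂(hyperPrior d c) ≤ ENNReal.ofReal e) :
    ∫⁻ z, ENNReal.ofReal (‖z‖ ^ 2 * tiltSq (mixing k d c) (‖z‖ ^ 2 / 2) +
        k * tiltMean (mixing k d c) (‖z‖ ^ 2 / 2)) ∂(stdGaussian (EuclideanSpace ℝ (Fin k))) ≤
      ENNReal.ofReal ((4 * L + k) * (e / b) + tailConst k * Real.exp (-(3 / 2) * L)) := by
  have hμ := ae_mixing k d c
  have hmean : Measurable (tiltMean (mixing k d c)) := measurable_integral_tilted _ measurable_id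
  have hpt : ∀ z : EuclideanSpace ℝ (Fin k),
      ENNReal.ofReal (‖z‖ ^ 2 * tiltSq (mixing k d c) (‖z‖ ^ 2 / 2) +
        k * tiltMean (mixing k d c) (‖z‖ ^ 2 / 2)) ≤
      ENNReal.ofReal (4 * L + k) * ENNReal.ofReal (tiltMean (mixing k d c) (‖z‖ ^ 2 / 2)) +
      ENNReal.ofReal ((16 + k) * Real.exp (-(3 / 2) * L)) *
        ENNReal.ofReal (Real.exp (7 / 8 * ‖z‖ ^ 2 / 2)) := by
    intro z
    have h1 := tiltSq_le_tiltMean hμ (‖z‖ ^ 2 / 2)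
    have h0 := tiltSq_nonneg (μ := mixing k d c) (‖z‖ ^ 2 / 2)
    have h2 := tiltMean_nonneg hμ (‖z‖ ^ 2 / 2)
    have h3 := tiltMean_le_one hμ (‖z‖ ^ 2 / 2)
    rw [← ENNReal.ofReal_mul (by positivity), ← ENNReal.ofReal_mul (by positivity)]
    rcases le_total (‖z‖ ^ 2) (4 * L) with h | h
    · refine le_add_right (ENNReal.ofReal_le_ofReal ?_)
      rw [add_mul]
      gcongr
    · refine le_add_left (ENNReal.ofReal_le_ofReal ?_)
      have h4 : ‖z‖ ^ 2 / 16 + 1 ≤ Real.exp (‖z‖ ^ 2 / 16) := Real.add_one_le_exp _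
      -- Since `7 / 16 - 1 / 16 = 3 / 8`, the threshold `4 L` yields the rate `3 L / 2`, more than
      -- the `L` needed against `n` terms; `7 / 8 < 1` keeps the moment finite.
      have h5 : Real.exp (‖z‖ ^ 2 / 16) ≤
          Real.exp (-(3 / 2) * L) * Real.exp (7 / 8 * ‖z‖ ^ 2 / 2) := by
        rw [← Real.exp_add, Real.exp_le_exp]
        linarith
      calc _ ≤ ‖z‖ ^ 2 * 1 + k * 1 := by gcongr; exact h1.trans h3
        _ ≤ (16 + k) * Real.exp (‖z‖ ^ 2 / 16) := by
          have h6 : (1 : ℝ) ≤ Real.exp (‖z‖ ^ 2 / 16) := Real.one_le_exp (by positivity)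
          have h7 : (k : ℝ) * 1 ≤ k * Real.exp (‖z‖ ^ 2 / 16) := by gcongr
          linarith
        _ ≤ (16 + k) * (Real.exp (-(3 / 2) * L) * Real.exp (7 / 8 * ‖z‖ ^ 2 / 2)) := by gcongr
        _ = _ := by ring
  refine (lintegral_mono hpt).trans ?_
  have heb : 0 ≤ e / b := by positivity
  have htc := tailConst_nonneg k
  rw [lintegral_add_left (by fun_prop), lintegral_const_mul _ (by fun_prop),
    lintegral_const_mul _ (by fun_prop), lintegral_exp_mul_norm_sq_stdGaussian (by norm_num),
    ENNReal.ofReal_add (p := (4 * L + k) * (e / b)) (by positivity) (by positivity),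
    ENNReal.ofReal_mul (p := 4 * L + k) (by positivity), finrank_euclideanSpace_fin]
  gcongr
  · exact lintegral_tiltMean_le hb hbm he
  · rw [← ENNReal.ofReal_mul (by positivity), tailConst]
    exact le_of_eq (by congr 1; ring)

end Null

/-! ### The hyperprior -/

section InvGamma

/-- Density of the Inverse-Gamma distribution. -/
noncomputable def invGammaPDF (a b t : ℝ) : ℝ :=
  if 0 < t then b ^ a / Real.Gamma a * Real.exp (-b / t) * t ^ (-a - 1) else 0

theorem measurable_invGammaPDF (a b : ℝ) : Measurable (invGammaPDF a b) :=
  Measurable.ite measurableSet_Ioi (by fun_prop) measurable_const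

theorem lintegral_invGammaMeasure (a b : ℝ) {f : ℝ → ℝ≥0∞} (hf : Measurable f) :
    ∫⁻ t, f t ∂(invGammaMeasure a b) =
      ∫⁻ t in Set.Ioi 0, ENNReal.ofReal (b ^ a / Real.Gamma a * Real.exp (-b / t) *
        t ^ (-a - 1)) * f t := by
  have h := measurable_invGammaPDF a b
  change ∫⁻ t, f t ∂(volume.withDensity fun t => ENNReal.ofReal (invGammaPDF a b t)) = _
  rw [lintegral_withDensity_eq_lintegral_mul _ (by fun_prop) hf,
    ← lintegral_indicator measurableSet_Ioi]
  refine lintegral_congr fun t => ?_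
  by_cases ht : 0 < t
  · simp [invGammaPDF, ht]
  · simp [invGammaPDF, ht]

theorem isProbabilityMeasure_invGammaMeasure {a b : ℝ} (ha : 0 < a) (hb : 0 < b) :
    IsProbabilityMeasure (invGammaMeasure a b) := by
  constructor
  rw [← lintegral_one, lintegral_invGammaMeasure _ _ measurable_const]
  simp only [mul_one]
  have hG := Real.Gamma_pos_of_pos ha
  set g : ℝ → ℝ := fun y => y ^ (a - 1) * Real.exp (-(b * y)) with hg
  have hval : ∫ y in Set.Ioi 0, g y = (1 / b) ^ a * Real.Gamma a :=
    Real.integral_rpow_mul_exp_neg_mul_Ioi ha hb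
  have hne : (1 / b) ^ a * Real.Gamma a ≠ 0 := by positivity
  -- The substitution `y = 1 / t` turns the integral into a Gamma integral.
  have hsub := integral_comp_rpow_Ioi g (p := -1) (by norm_num)
  have heq : ∫ t in Set.Ioi (0 : ℝ), Real.exp (-b / t) * t ^ (-a - 1) =
      (1 / b) ^ a * Real.Gamma a := by
    rw [← hval, ← hsub]
    refine setIntegral_congr_fun measurableSet_Ioi fun t ht => ?_
    have ht0 : (0 : ℝ) < t := ht
    simp only [hg, abs_neg, abs_one, one_mul, smul_eq_mul]
    rw [← Real.rpow_mul ht0.le, ← mul_assoc, ← Real.rpow_add ht0, Real.rpow_neg_one, mul_comm]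
    congr 2
    · ring
    · ring
  -- A non-integrable function has Bochner integral `0`, so a non-zero value proves integrability.
  have hint : IntegrableOn (fun t : ℝ => Real.exp (-b / t) * t ^ (-a - 1)) (Set.Ioi 0) :=
    Integrable.of_integral_ne_zero (by rw [heq]; exact hne)
  simp_rw [mul_assoc]
  rw [← ofReal_integral_eq_lintegral_ofReal (hint.const_mul _), integral_const_mul, heq]
  · rw [Real.div_rpow zero_le_one hb.le, Real.one_rpow]
    have : 0 < b ^ a := by positivity
    rw [show b ^ a / Real.Gamma a * (1 / b ^ a * Real.Gamma a) = 1 by field_simp]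
    simp
  · refine (ae_restrict_iff' measurableSet_Ioi).2 (Eventually.of_forall fun t ht => ?_)
    have ht0 : (0 : ℝ) < t := ht
    simp only [Pi.zero_apply]
    positivity

theorem isProbabilityMeasure_hyperPrior {d c : ℝ} (hd : 0 < d) (hc : 0 < c) :
    IsProbabilityMeasure (hyperPrior d c) := by
  have := isProbabilityMeasure_expMeasure (r := 1 / 2) (by norm_num)
  have := isProbabilityMeasure_invGammaMeasure hd (half_pos hc)
  unfold hyperPrior
  infer_instance

/-- Dropping the exponential leaves `t ^ (-a)` on `(0, 1]`, integrable as `a < 1`, and `t ^ (-a -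
1)` beyond, integrable as `a > 0`. The factor `b ^ a` is the source of `c ^ d`. -/
theorem lintegral_min_one_invGammaMeasure_le {a b : ℝ} (ha : 0 < a) (ha1 : a < 1) (hb : 0 < b) :
    ∫⁻ t, ENNReal.ofReal (min 1 |t|) ∂(invGammaMeasure a b) ≤
      ENNReal.ofReal (b ^ a / Real.Gamma a * (1 / (1 - a) + 1 / a)) := by
  have hG := Real.Gamma_pos_of_pos ha
  have hK : 0 < b ^ a / Real.Gamma a := by positivity
  have h1a : 0 < 1 - a := by linarith
  have hpt : ∀ t, 0 < t → Real.exp (-b / t) ≤ 1 := fun t ht => by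
    rw [Real.exp_le_one_iff, neg_div]
    have : 0 < b / t := by positivity
    linarith
  have hlow : ∫⁻ t in Set.Ioc (0 : ℝ) 1, ENNReal.ofReal (t ^ (-a)) =
      ENNReal.ofReal (1 / (1 - a)) := by
    have hi : IntervalIntegrable (fun t : ℝ => t ^ (-a)) volume 0 1 :=
      intervalIntegral.intervalIntegrable_rpow' (by linarith)
    rw [← ofReal_integral_eq_lintegral_ofReal
      ((intervalIntegrable_iff_integrableOn_Ioc_of_le zero_le_one).1 hi),
      ← intervalIntegral.integral_of_le zero_le_one, integral_rpow (Or.inl (by linarith))]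
    · rw [Real.one_rpow, Real.zero_rpow (by linarith)]
      congr 1
      ring
    · exact (ae_restrict_iff' measurableSet_Ioc).2
        (Eventually.of_forall fun t ht => Real.rpow_nonneg ht.1.le _)
  have hhigh : ∫⁻ t in Set.Ioi (1 : ℝ), ENNReal.ofReal (t ^ (-a - 1)) =
      ENNReal.ofReal (1 / a) := by
    rw [← ofReal_integral_eq_lintegral_ofReal
      (integrableOn_Ioi_rpow_of_lt (by linarith) zero_lt_one),
      integral_Ioi_rpow_of_lt (by linarith) zero_lt_one]
    · rw [Real.one_rpow]
      congr 1
      rw [sub_add_cancel, neg_div_neg_eq]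
    · exact (ae_restrict_iff' measurableSet_Ioi).2
        (Eventually.of_forall fun t ht => Real.rpow_nonneg (zero_le_one.trans (le_of_lt ht)) _)
  rw [lintegral_invGammaMeasure _ _ (by fun_prop), ← Set.Ioc_union_Ioi_eq_Ioi zero_le_one,
    lintegral_union measurableSet_Ioi (Set.Ioc_disjoint_Ioi le_rfl), mul_add,
    ENNReal.ofReal_add (by positivity) (by positivity), ENNReal.ofReal_mul hK.le,
    ENNReal.ofReal_mul hK.le, ← hlow, ← hhigh, ← lintegral_const_mul _ (by fun_prop),
    ← lintegral_const_mul _ (by fun_prop)]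
  gcongr ?_ + ?_
  · refine setLIntegral_mono (by fun_prop) fun t ht => ?_
    have ht0 := ht.1
    rw [← ENNReal.ofReal_mul (by positivity), ← ENNReal.ofReal_mul hK.le]
    refine ENNReal.ofReal_le_ofReal ?_
    rw [abs_of_pos ht0, min_eq_right ht.2]
    calc _ ≤ b ^ a / Real.Gamma a * 1 * t ^ (-a - 1) * t := by gcongr; exact hpt t ht0
      _ = b ^ a / Real.Gamma a * (t ^ (-a - 1) * t ^ (1 : ℝ)) := by rw [Real.rpow_one]; ring
      _ = _ := by rw [← Real.rpow_add ht0, sub_add_cancel]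
  · refine setLIntegral_mono (by fun_prop) fun t ht => ?_
    have ht0 : (0 : ℝ) < t := zero_lt_one.trans ht
    rw [← ENNReal.ofReal_mul (by positivity), ← ENNReal.ofReal_mul hK.le]
    refine ENNReal.ofReal_le_ofReal ?_
    calc _ ≤ b ^ a / Real.Gamma a * 1 * t ^ (-a - 1) * 1 := by
          gcongr
          · exact hpt t ht0
          · exact min_le_left _ _
      _ = _ := by ring

/-- On this interval `b / t ≤ 1` and `t ^ (a + 1) ≤ (2 s)²`; the length is `s`. The loss of a power
of `s` is harmless, as only its logarithm matters later. -/
theorem invGammaMeasure_Icc_ge {a b s : ℝ} (ha : 0 < a) (ha1 : a < 1) (hb : 0 < b) (hb1 : b ≤ 1)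
    (hs : 1 ≤ s) :
    ENNReal.ofReal (b ^ a / Real.Gamma a * Real.exp (-1) / (4 * s)) ≤
      invGammaMeasure a b (Set.Icc s (2 * s)) := by
  have hG := Real.Gamma_pos_of_pos ha
  have hs0 : 0 < s := by linarith
  have h1 : invGammaMeasure a b (Set.Icc s (2 * s)) =
      ∫⁻ t in Set.Icc s (2 * s), ENNReal.ofReal (invGammaPDF a b t) :=
    withDensity_apply _ measurableSet_Icc
  have h2 : ENNReal.ofReal (b ^ a / Real.Gamma a * Real.exp (-1) / (4 * s)) =
      ∫⁻ _ in Set.Icc s (2 * s),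
        ENNReal.ofReal (b ^ a / Real.Gamma a * Real.exp (-1) * (1 / (2 * s) ^ 2)) := by
    rw [setLIntegral_const, Real.volume_Icc, ← ENNReal.ofReal_mul (by positivity)]
    congr 1
    field_simp
    ring
  rw [h1, h2]
  refine setLIntegral_mono (by have := measurable_invGammaPDF a b; fun_prop) fun t ht => ?_
  have ht0 : 0 < t := hs0.trans_le ht.1
  refine ENNReal.ofReal_le_ofReal ?_
  rw [invGammaPDF, if_pos ht0]
  have h3 : Real.exp (-1) ≤ Real.exp (-b / t) := by
    rw [Real.exp_le_exp, neg_div, neg_le_neg_iff, div_le_one ht0]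
    exact hb1.trans (hs.trans ht.1)
  have h4 : 1 / (2 * s) ^ 2 ≤ t ^ (-a - 1) := by
    have h5 : t ^ (-a - 1) = 1 / t ^ (a + 1) := by
      rw [show -a - 1 = -(a + 1) by ring, Real.rpow_neg ht0.le, one_div]
    rw [h5]
    refine one_div_le_one_div_of_le (by positivity) ?_
    calc t ^ (a + 1) ≤ t ^ (2 : ℝ) :=
          Real.rpow_le_rpow_of_exponent_le (hs.trans ht.1) (by linarith)
      _ = t ^ 2 := Real.rpow_two t
      _ ≤ (2 * s) ^ 2 := by gcongr; exact ht.2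
  gcongr

end InvGamma

section ExpMeasure

theorem lintegral_one_add_abs_expMeasure_le :
    ∫⁻ x, ENNReal.ofReal (1 + |x|) ∂(expMeasure (1 / 2)) ≤ ENNReal.ofReal 8 := by
  have h0 : expMeasure (1 / 2) = volume.withDensity (exponentialPDF (1 / 2)) := rfl
  have hm : ∀ r, Measurable (exponentialPDF r) :=
    fun r => (measurable_exponentialPDFReal r).ennreal_ofReal
  rw [h0, lintegral_withDensity_eq_lintegral_mul _ (hm _) (by fun_prop)]
  -- From `1 + x ≤ 4 exp (x / 4)`; trading rate `1 / 2` for `1 / 4` costs another factor `2`.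
  calc _ ≤ ∫⁻ x, ENNReal.ofReal 8 * exponentialPDF (1 / 4) x := by
        refine lintegral_mono fun x => ?_
        simp only [Pi.mul_apply]
        rcases lt_or_ge x 0 with hx | hx
        · simp [exponentialPDF_of_neg hx]
        · rw [exponentialPDF_of_nonneg hx, exponentialPDF_of_nonneg hx,
            ← ENNReal.ofReal_mul (by positivity), ← ENNReal.ofReal_mul (by positivity)]
          refine ENNReal.ofReal_le_ofReal ?_
          rw [abs_of_nonneg hx]
          have h1 : x / 4 + 1 ≤ Real.exp (x / 4) := Real.add_one_le_exp _
          have h2 : Real.exp (-(1 / 4 * x)) = Real.exp (-(1 / 2 * x)) * Real.exp (x / 4) := by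
            rw [← Real.exp_add]; congr 1; ring
          rw [h2]
          have h3 := Real.exp_pos (-(1 / 2 * x))
          nlinarith
    _ = _ := by
        rw [lintegral_const_mul _ (hm _), lintegral_exponentialPDF_eq_one (by norm_num), mul_one]

/-- Probability of `[1, 2]` under the exponential distribution with mean `2`. -/
noncomputable def expMass : ℝ := (expMeasure (1 / 2)).real (Set.Icc 1 2)

theorem expMass_pos : 0 < expMass := by
  have := isProbabilityMeasure_expMeasure (r := 1 / 2) (by norm_num)
  have h0 : expMeasure (1 / 2) = volume.withDensity (exponentialPDF (1 / 2)) := rfl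
  rw [expMass, Measure.real, ENNReal.toReal_pos_iff]
  refine ⟨?_, measure_lt_top _ _⟩
  rw [h0, withDensity_apply _ measurableSet_Icc]
  calc (0 : ℝ≥0∞) < ∫⁻ _ in Set.Icc (1 : ℝ) 2, ENNReal.ofReal (1 / 2 * Real.exp (-1)) := by
        rw [setLIntegral_const, Real.volume_Icc, ← ENNReal.ofReal_mul (by positivity),
          ENNReal.ofReal_pos]
        have := Real.exp_pos (-1)
        linarith
    _ ≤ _ := by
        refine setLIntegral_mono (measurable_exponentialPDFReal _).ennreal_ofReal fun x hx => ?_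
        rw [exponentialPDF_of_nonneg (by linarith [hx.1])]
        refine ENNReal.ofReal_le_ofReal ?_
        gcongr
        linarith [hx.2]

end ExpMeasure

section HyperPrior

theorem sqrt_sq_le_abs_mul (x y : ℝ) : √(x * y) ^ 2 ≤ |x| * |y| := by
  rw [← abs_mul]
  calc √(x * y) ^ 2 ≤ √|x * y| ^ 2 := by gcongr; exact le_abs_self _
    _ = |x * y| := Real.sq_sqrt (abs_nonneg _)

/-- Follows from `v ≤ min 1 u`, in a form that separates `λ²` from `τ` so that the prior mean
factorises. -/
theorem shrink_le (p : ℝ × ℝ) : shrink p ≤ (1 + |p.1|) * min 1 |p.2| := by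
  have h1 := (shrink_lt_one p).le
  have h2 : shrink p ≤ |p.1| * |p.2| := by
    refine le_trans ?_ (sqrt_sq_le_abs_mul p.1 p.2)
    exact div_le_self (sq_nonneg _) (by linarith [sq_nonneg √(p.1 * p.2)])
  have h3 := abs_nonneg p.1
  have h4 := abs_nonneg p.2
  rcases le_total 1 |p.2| with h | h
  · rw [min_eq_left h]; linarith
  · rw [min_eq_right h]; linarith

/-- The constant in the bound on the prior mean of the shrinkage factor. -/
noncomputable def shrinkConst (d : ℝ) : ℝ :=
  8 * ((1 / 2) ^ d / Real.Gamma d * (1 / (1 - d) + 1 / d))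

theorem shrinkConst_pos {d : ℝ} (hd : 0 < d) (hd1 : d < 1) : 0 < shrinkConst d := by
  have hG := Real.Gamma_pos_of_pos hd
  have : 0 < 1 - d := by linarith
  unfold shrinkConst
  positivity

theorem lintegral_shrink_le {d c : ℝ} (hd : 0 < d) (hd1 : d < 1) (hc : 0 < c) :
    ∫⁻ p, ENNReal.ofReal (shrink p) ∂(hyperPrior d c) ≤
      ENNReal.ofReal (shrinkConst d * c ^ d) := by
  have := isProbabilityMeasure_expMeasure (r := 1 / 2) (by norm_num)
  have := isProbabilityMeasure_invGammaMeasure hd (half_pos hc)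
  calc _ ≤ ∫⁻ p, ENNReal.ofReal (1 + |p.1|) * ENNReal.ofReal (min 1 |p.2|) ∂(hyperPrior d c) := by
        refine lintegral_mono fun p => ?_
        rw [← ENNReal.ofReal_mul (by positivity)]
        exact ENNReal.ofReal_le_ofReal (shrink_le p)
    _ = (∫⁻ x, ENNReal.ofReal (1 + |x|) ∂(expMeasure (1 / 2))) *
          ∫⁻ t, ENNReal.ofReal (min 1 |t|) ∂(invGammaMeasure d (c / 2)) :=
        lintegral_prod_mul (f := fun x => ENNReal.ofReal (1 + |x|))
          (g := fun t => ENNReal.ofReal (min 1 |t|)) (by fun_prop) (by fun_prop)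
    _ ≤ ENNReal.ofReal 8 *
          ENNReal.ofReal ((c / 2) ^ d / Real.Gamma d * (1 / (1 - d) + 1 / d)) :=
        mul_le_mul' lintegral_one_add_abs_expMeasure_le
          (lintegral_min_one_invGammaMeasure_le hd hd1 (half_pos hc))
    _ = _ := by
        rw [← ENNReal.ofReal_mul (by norm_num), shrinkConst, div_eq_mul_one_div c 2,
          Real.mul_rpow hc.le (by norm_num)]
        congr 1
        ring

/-- With `a = √(1 / 2) ^ k`, pointwise `a ≤ √(1 - v) ^ k + 2 a v`: use the first term for `v ≤ 1 /
2`, the second otherwise. Integrate against the prior, where `v` has mean at most `1 / 4`. -/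
theorem mixing_univ_ge {k : ℕ} {d c e : ℝ} [IsProbabilityMeasure (hyperPrior d c)]
    (he : ∫⁻ p, ENNReal.ofReal (shrink p) ∂(hyperPrior d c) ≤ ENNReal.ofReal e)
    (he4 : e ≤ 1 / 4) :
    ENNReal.ofReal (√(1 / 2) ^ k / 2) ≤ mixing k d c Set.univ := by
  have hms := measurable_shrink
  set a := √(1 / 2) ^ k with ha
  have ha0 : 0 < a := by positivity
  have h1 : mixing k d c Set.univ =
      ∫⁻ p, ENNReal.ofReal (√(1 - shrink p) ^ k) ∂(hyperPrior d c) := by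
    rw [← lintegral_one, lintegral_mixing _ _ _ measurable_const]
    simp
  have h2 : ENNReal.ofReal a ≤ mixing k d c Set.univ + ENNReal.ofReal (a / 2) := by
    calc ENNReal.ofReal a = ∫⁻ _, ENNReal.ofReal a ∂(hyperPrior d c) := by simp
      _ ≤ ∫⁻ p, (ENNReal.ofReal (√(1 - shrink p) ^ k) +
            ENNReal.ofReal (2 * a) * ENNReal.ofReal (shrink p)) ∂(hyperPrior d c) := by
          refine lintegral_mono fun p => ?_
          have h0 := shrink_nonneg p
          rw [← ENNReal.ofReal_mul (by positivity), ← ENNReal.ofReal_add (by positivity)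
            (by positivity)]
          refine ENNReal.ofReal_le_ofReal ?_
          rcases le_total (shrink p) (1 / 2) with h | h
          · have h3 : a ≤ √(1 - shrink p) ^ k := by
              rw [ha]
              gcongr
              linarith
            have : 0 ≤ 2 * a * shrink p := by positivity
            linarith
          · have : 0 ≤ √(1 - shrink p) ^ k := by positivity
            nlinarith
      _ ≤ mixing k d c Set.univ + ENNReal.ofReal (2 * a) * ENNReal.ofReal (1 / 4) := by
          rw [lintegral_add_left (by fun_prop), lintegral_const_mul _ (by fun_prop), ← h1]
          gcongr
          exact he.trans (ENNReal.ofReal_le_ofReal he4)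
      _ = _ := by
          rw [← ENNReal.ofReal_mul (by positivity)]
          congr 2
          ring
  calc ENNReal.ofReal (a / 2) = ENNReal.ofReal a - ENNReal.ofReal (a / 2) := by
        rw [← ENNReal.ofReal_sub _ (by positivity)]
        congr 1
        ring
    _ ≤ _ := tsub_le_iff_right.2 h2

/-- The constant in the lower bound on the exponential moments of `mixing`. -/
noncomputable def momentConst (k : ℕ) (d : ℝ) : ℝ :=
  Real.exp (-2) * (1 / 5) ^ k * expMass * ((1 / 2) ^ d / Real.Gamma d) / 4

theorem momentConst_pos (k : ℕ) {d : ℝ} (hd : 0 < d) : 0 < momentConst k d := by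
  have hG := Real.Gamma_pos_of_pos hd
  have := expMass_pos
  unfold momentConst
  positivity

/-- Restrict to `λ² ∈ [1, 2]` and `τ ∈ [s, 2 s]`. There `s ≤ u ≤ 4 s`, so `1 / (5 s) ≤ 1 - v ≤ 1 /
s`: the tilt is at least `exp (s - 1)` and the weight at least `(5 s) ^ (-k)`. The last power of `s`
comes from the mass of the box. -/
theorem le_integral_exp_mixing {k : ℕ} {d c s : ℝ} (hd : 0 < d) (hd1 : d < 1) (hc : 0 < c)
    (hc1 : c ≤ 1) (hs : 1 ≤ s) :
    momentConst k d * c ^ d * Real.exp s / s ^ (k + 1) ≤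
      ∫ v, Real.exp (s * v) ∂(mixing k d c) := by
  have hprob := isProbabilityMeasure_hyperPrior hd hc
  have hE := isProbabilityMeasure_expMeasure (r := 1 / 2) (by norm_num)
  have hI := isProbabilityMeasure_invGammaMeasure hd (half_pos hc)
  have hG := Real.Gamma_pos_of_pos hd
  have hM := expMass_pos
  have hs0 : 0 < s := by linarith
  have hms := measurable_shrink
  have hpos := integral_mixing_exp_pos (k := k) (d := d) (c := c) s
  rw [← ENNReal.ofReal_le_ofReal_iff hpos.le, ← lintegral_mixing_exp,
    lintegral_mixing _ _ _ (by fun_prop)]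
  set A := Real.exp (-1) * Real.exp s * ((1 / 5) ^ k / s ^ k)
  calc _ = ENNReal.ofReal (A * (expMass *
          ((c / 2) ^ d / Real.Gamma d * Real.exp (-1) / (4 * s)))) := by
        congr 1
        rw [momentConst, div_eq_mul_one_div c 2, Real.mul_rpow hc.le (by norm_num),
          show (-2 : ℝ) = -1 + -1 by norm_num, Real.exp_add]
        simp only [A]
        field_simp
        rw [pow_succ]
    _ ≤ ENNReal.ofReal A * (expMeasure (1 / 2) (Set.Icc 1 2) *
          invGammaMeasure d (c / 2) (Set.Icc s (2 * s))) := by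
        rw [ENNReal.ofReal_mul (by positivity), ENNReal.ofReal_mul hM.le]
        gcongr
        · rw [expMass, ofReal_measureReal]
        · exact invGammaMeasure_Icc_ge hd hd1 (half_pos hc) (by linarith) hs
    _ = ∫⁻ _ in Set.Icc 1 2 ×ˢ Set.Icc s (2 * s), ENNReal.ofReal A ∂(hyperPrior d c) := by
        rw [setLIntegral_const, hyperPrior, Measure.prod_prod]
    _ ≤ ∫⁻ p in Set.Icc 1 2 ×ˢ Set.Icc s (2 * s), ENNReal.ofReal (√(1 - shrink p) ^ k) *
          ENNReal.ofReal (Real.exp (s * shrink p)) ∂(hyperPrior d c) := by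
        refine setLIntegral_mono (by fun_prop) fun p hp => ?_
        obtain ⟨⟨h1, h2⟩, h3, h4⟩ := hp
        rw [← ENNReal.ofReal_mul (by positivity)]
        refine ENNReal.ofReal_le_ofReal ?_
        have hu : √(p.1 * p.2) ^ 2 = p.1 * p.2 := Real.sq_sqrt (by nlinarith)
        have hu1 : s ≤ p.1 * p.2 := by nlinarith
        have hu2 : p.1 * p.2 ≤ 4 * s := by nlinarith
        have hgap : 1 - shrink p = 1 / (1 + p.1 * p.2) := by
          rw [shrink, hu]
          have : 1 + p.1 * p.2 ≠ 0 := by linarith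
          field_simp
          ring
        have hg1 : s * (1 - shrink p) ≤ 1 := by
          rw [hgap, mul_one_div, div_le_one (by linarith)]
          linarith
        have hg2 : 1 / 5 / s ≤ √(1 - shrink p) := by
          have h5 : 1 / (5 * s) ≤ 1 - shrink p := by
            rw [hgap]
            exact one_div_le_one_div_of_le (by linarith) (by linarith)
          refine Real.le_sqrt_of_sq_le (le_trans ?_ h5)
          rw [div_div]
          have h6 : 1 / (5 * s) ≤ 1 := by
            rw [div_le_one (by positivity)]
            linarith
          have h7 : 0 ≤ 1 / (5 * s) := by positivity
          nlinarith
        calc A = (1 / 5 / s) ^ k * Real.exp (s - 1) := by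
              simp only [A]
              rw [sub_eq_add_neg, Real.exp_add, div_pow (1 / 5) s,
                mul_comm (Real.exp (-1))]
              exact mul_comm _ _
          _ ≤ _ := by
              gcongr
              linarith
    _ ≤ _ := setLIntegral_le_lintegral _ _

end HyperPrior

/-- The constant in the bound on the second moment of the posterior about the observation. -/
noncomputable def gapConst (k : ℕ) (d : ℝ) : ℝ :=
  128 + 24 * Real.log (momentConst k d) ^ 2 + 96 * (k + 1) ^ 2

theorem gapConst_nonneg (k : ℕ) (d : ℝ) : 0 ≤ gapConst k d := by
  unfold gapConst
  positivity

/-- Taking logarithms in `le_integral_exp_mixing` bounds `s - log m` by a constant plus `2 |L| + (k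
+ 1) log s`. Its square is `O(1 + L² + s)` because `log s ≤ 2 √s`; insert this in
`sq_mul_tiltGap_le` and divide by `s`. -/
theorem tiltGap_mixing_le {k : ℕ} {d c L s : ℝ} (hd : 0 < d) (hd1 : d < 1) (hc : 0 < c)
    (hc1 : c ≤ 1) (hcL : -(d * Real.log c) ≤ 2 * L) (hs : 1 ≤ s) :
    2 * s * tiltGap (mixing k d c) s ≤ gapConst k d * (1 + L ^ 2 / s) := by
  have hprob := isProbabilityMeasure_hyperPrior hd hc
  have hs0 : 0 < s := by linarith
  have hg := momentConst_pos k hd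
  have hint := integrable_exp_mul_of_mem_Icc (ae_mixing k d c) s
  have hpos := integral_mixing_exp_pos (k := k) (d := d) (c := c) s
  have hle := le_integral_exp_mixing (k := k) hd hd1 hc hc1 hs
  have hbase := sq_mul_tiltGap_le (ae_mixing k d c) mixing_univ_le_one hs0.le
  set m := ∫ v, Real.exp (s * v) ∂(mixing k d c)
  set g := momentConst k d
  have hub : Real.log m ≤ s := by
    rw [Real.log_le_iff_le_exp hpos]
    have hreal : (mixing k d c).real Set.univ ≤ 1 :=
      ENNReal.toReal_le_of_le_ofReal zero_le_one (by simpa using mixing_univ_le_one)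
    calc m ≤ ∫ _, Real.exp s ∂(mixing k d c) := by
          refine integral_mono_ae hint (integrable_const _) ?_
          filter_upwards [ae_mixing k d c] with v hv
          exact Real.exp_le_exp.2 (by nlinarith [hv.2])
      _ = (mixing k d c).real Set.univ * Real.exp s := by simp
      _ ≤ 1 * Real.exp s := by gcongr
      _ = Real.exp s := one_mul _
  have hlog : s - Real.log m ≤ |Real.log g| + 2 * |L| + (k + 1) * Real.log s := by
    have h1 := Real.log_le_log (by positivity) hle
    rw [Real.log_div (by positivity) (by positivity), Real.log_mul (by positivity) (by positivity),
      Real.log_mul hg.ne' (by positivity), Real.log_exp, Real.log_pow, Real.log_rpow hc] at h1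
    push_cast at h1
    have h2 := neg_abs_le (Real.log g)
    have h3 := le_abs_self L
    linarith
  have hlogs : Real.log s ^ 2 ≤ 4 * s := by
    have h1 : Real.log s = 2 * Real.log √s := by rw [Real.log_sqrt hs0.le]; ring
    have h2 : Real.log √s ≤ √s := Real.log_le_self (Real.sqrt_nonneg s)
    have h3 : 0 ≤ Real.log √s := Real.log_nonneg (Real.one_le_sqrt.2 hs)
    have h4 : Real.log √s ^ 2 ≤ √s ^ 2 := by gcongr
    rw [Real.sq_sqrt hs0.le] at h4
    rw [h1]
    linarith
  have hsq : (s - Real.log m) ^ 2 ≤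
      3 * (Real.log g ^ 2 + 4 * L ^ 2 + (k + 1) ^ 2 * (4 * s)) := by
    have h1 : (s - Real.log m) ^ 2 ≤ (|Real.log g| + 2 * |L| + (k + 1) * Real.log s) ^ 2 := by
      have : 0 ≤ s - Real.log m := by linarith
      gcongr
    have h2 : ∀ x y z : ℝ, (x + y + z) ^ 2 ≤ 3 * (x ^ 2 + y ^ 2 + z ^ 2) := fun x y z => by
      nlinarith [sq_nonneg (x - y), sq_nonneg (x - z), sq_nonneg (y - z)]
    refine h1.trans ((h2 _ _ _).trans ?_)
    rw [sq_abs, mul_pow, sq_abs, mul_pow]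
    have h3 : ((k : ℝ) + 1) ^ 2 * Real.log s ^ 2 ≤ (k + 1) ^ 2 * (4 * s) := by gcongr
    linarith
  -- Expanding gives `24 log² g + 96 L² + 96 (k + 1)² s + 32`; the `128` in `gapConst` covers the
  -- coefficients `96` of `L²` and `32`, and `s ≥ 1` absorbs the constants.
  have hmain : s * (2 * s * tiltGap (mixing k d c) s) ≤ gapConst k d * (s + L ^ 2) := by
    have h1 : s * (2 * s * tiltGap (mixing k d c) s) =
        2 * (s ^ 2 * tiltGap (mixing k d c) s) := by ring
    have h2 : gapConst k d = 128 + 24 * Real.log g ^ 2 + 96 * (k + 1) ^ 2 := rfl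
    rw [h1, h2]
    have h3 : 0 ≤ (24 * Real.log g ^ 2 + 32) * (s - 1) := by
      have : 0 ≤ s - 1 := by linarith
      positivity
    have h4 : 0 ≤ (24 * Real.log g ^ 2 + 96 * ((k : ℝ) + 1) ^ 2) * L ^ 2 := by positivity
    nlinarith [sq_nonneg L]
  have h5 : gapConst k d * (1 + L ^ 2 / s) = gapConst k d * (s + L ^ 2) / s := by
    field_simp
  rw [h5, le_div_iff₀ hs0]
  linarith

/-! ### Bounds that are uniform over nearly-black arrays -/

section Uniform

variable {k n : ℕ} {S : Matrix (Fin k) (Fin k) ℝ} {d c q : ℝ} [IsProbabilityMeasure (hyperPrior d c)]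

theorem missProb_le_of_nearlyBlack (hS : S.PosDef) {N : EuclideanSpace ℝ (Fin k) → ℝ}
    (hN : Measurable N) (hN0 : ∀ x, 0 ≤ N x)
    {centre : (Fin n → EuclideanSpace ℝ (Fin k)) → Fin n → EuclideanSpace ℝ (Fin k)}
    {G : Fin n → EuclideanSpace ℝ (Fin k) → ℝ≥0∞} (hG : ∀ i, Measurable (G i))
    (h : ∀ X i, ∫⁻ t, ENNReal.ofReal (N (t - centre X i))
      ∂(bayes (priorOne S d c) fun t => gaussianDensity S t (X i)) ≤ G i (X i))
    {θ₀ : Fin n → EuclideanSpace ℝ (Fin k)} (hθ : θ₀ ∈ nearlyBlack k n q)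
    {a b : ℝ} (ha : 0 ≤ a) (hb : 0 ≤ b)
    (hGa : ∀ i, θ₀ i ≠ 0 → ∫⁻ z, G i (θ₀ i + sqrtCLM S z)
      ∂(stdGaussian (EuclideanSpace ℝ (Fin k))) ≤ ENNReal.ofReal a)
    (hGb : ∀ i, θ₀ i = 0 → ∫⁻ z, G i (sqrtCLM S z)
      ∂(stdGaussian (EuclideanSpace ℝ (Fin k))) ≤ ENNReal.ofReal b)
    {r : ℝ} (hr : 0 < r) :
    missProb S d c N centre r θ₀ ≤ ENNReal.ofReal ((q * a + n * b) / r) := by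
  classical
  have hq : (((Finset.univ.filter fun i => θ₀ i ≠ 0).card : ℕ) : ℝ) ≤ q := by
    have h1 : (({i | θ₀ i ≠ 0} : Set (Fin n)).ncard : ℝ) ≤ q := hθ
    rwa [Set.ncard_eq_toFinset_card', Set.toFinset_ofPred] at h1
  rw [ENNReal.ofReal_div_of_pos hr]
  refine (missProb_le hS hN hN0 hG h hr θ₀).trans ?_
  gcongr
  -- Charging `b` to every index leaves only the number of non-zero means to be bounded by `q`.
  calc _ ≤ ∑ i, ENNReal.ofReal ((if θ₀ i ≠ 0 then a else 0) + b) := by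
        refine Finset.sum_le_sum fun i _ => ?_
        by_cases hi : θ₀ i = 0
        · have h1 := hGb i hi
          simpa [hi] using h1
        · refine (hGa i hi).trans (ENNReal.ofReal_le_ofReal ?_)
          simp [hi, hb]
    _ = ENNReal.ofReal (∑ i, ((if θ₀ i ≠ 0 then a else 0) + b)) := by
        refine (ENNReal.ofReal_sum_of_nonneg fun i _ => ?_).symm
        split_ifs <;> positivity
    _ ≤ _ := by
        refine ENNReal.ofReal_le_ofReal ?_
        rw [Finset.sum_add_distrib, ← Finset.sum_filter, Finset.sum_const, Finset.sum_const,
          Finset.card_univ, Fintype.card_fin, nsmul_eq_mul, nsmul_eq_mul]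
        gcongr

variable (hS : S.PosDef) {N : EuclideanSpace ℝ (Fin k) → ℝ} (hNm : Measurable N)
  (hN0 : ∀ x, 0 ≤ N x) {C : ℝ}
  (hC0 : 0 ≤ C) (hC : ∀ z, N (sqrtCLM S z) ≤ C * ‖z‖ ^ 2) {K L b : ℝ} (hK : 0 ≤ K)
  (hgap : ∀ s, 1 ≤ s → 2 * s * tiltGap (mixing k d c) s ≤ K * (1 + L ^ 2 / s))
  (hnull : ∫⁻ z, ENNReal.ofReal (‖z‖ ^ 2 * tiltSq (mixing k d c) (‖z‖ ^ 2 / 2) +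
        k * tiltMean (mixing k d c) (‖z‖ ^ 2 / 2)) ∂(stdGaussian (EuclideanSpace ℝ (Fin k))) ≤
      ENNReal.ofReal b) (hb : 0 ≤ b)
  {θ₀ : Fin n → EuclideanSpace ℝ (Fin k)} (hθ : θ₀ ∈ nearlyBlack k n q)

include hS hNm hN0 hC0 hC hK hgap hnull hb hθ

theorem missProb_estimator_le {r : ℝ} (hr : 2 ≤ r) {R : ℝ} (hR : 0 < R) :
    missProb S d c N (fun X i => estimator S d c (X i)) R θ₀ ≤
      ENNReal.ofReal ((q * (3 * C * (k * r + K * (1 + 2 * L ^ 2 / r ^ 2) + k)) +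
        n * (3 * C * b)) / R) := by
  have hμ := ae_mixing k d c
  have hr0 : 0 < r := by linarith
  have hQ := measurable_mahalanobisSq S
  have hmV := measurable_tiltVar hμ
  have hmM : Measurable (tiltMean (mixing k d c)) := measurable_integral_tilted _ measurable_id
  refine missProb_le_of_nearlyBlack hS hNm hN0
    (G := fun _ x => ENNReal.ofReal (3 * C * (mahalanobisSq S x *
      tiltVar (mixing k d c) (mahalanobisSq S x / 2) +
      k * tiltMean (mixing k d c) (mahalanobisSq S x / 2)))) (fun i => by fun_prop) ?_ hθ
    (by positivity) (by positivity) ?_ ?_ hR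
  · intro X i
    obtain ⟨y, hy⟩ := sqrtCLM_surjective hS (X i)
    rw [← hy, mahalanobisSq_sqrtCLM hS]
    exact lintegral_bayes_sub_estimator_le hS hNm hC0 hC y
  · intro i _
    obtain ⟨η, hη⟩ := sqrtCLM_surjective hS (θ₀ i)
    simp_rw [← hη, ← map_add, mahalanobisSq_sqrtCLM hS]
    calc _ ≤ ∫⁻ z, ENNReal.ofReal (3 * C) * (ENNReal.ofReal (‖η + z‖ ^ 2 *
            tiltVar (mixing k d c) (‖η + z‖ ^ 2 / 2)) + ENNReal.ofReal k)
            ∂(stdGaussian (EuclideanSpace ℝ (Fin k))) := by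
          refine lintegral_mono fun z => ?_
          have h0 := tiltVar_nonneg (μ := mixing k d c) (‖η + z‖ ^ 2 / 2)
          have h1 := tiltMean_le_one hμ (‖η + z‖ ^ 2 / 2)
          rw [← ENNReal.ofReal_add (by positivity) (by positivity),
            ← ENNReal.ofReal_mul (by positivity)]
          refine ENNReal.ofReal_le_ofReal ?_
          have h2 : (k : ℝ) * tiltMean (mixing k d c) (‖η + z‖ ^ 2 / 2) ≤ k :=
            mul_le_of_le_one_right (Nat.cast_nonneg k) h1
          gcongr
      _ ≤ _ := by
          rw [lintegral_const_mul _ (by fun_prop), lintegral_add_right _ measurable_const,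
            lintegral_const, measure_univ, mul_one, ENNReal.ofReal_mul (p := 3 * C) (by positivity),
            ENNReal.ofReal_add (q := (k : ℝ)) (by positivity) (by positivity)]
          refine mul_le_mul' le_rfl (add_le_add ?_ le_rfl)
          exact lintegral_norm_sq_mul_tiltVar_le hμ hgap hK hr η
  · intro i _
    simp_rw [mahalanobisSq_sqrtCLM hS]
    calc _ ≤ ∫⁻ z, ENNReal.ofReal (3 * C) * ENNReal.ofReal (‖z‖ ^ 2 *
            tiltSq (mixing k d c) (‖z‖ ^ 2 / 2) + k * tiltMean (mixing k d c) (‖z‖ ^ 2 / 2))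
            ∂(stdGaussian (EuclideanSpace ℝ (Fin k))) := by
          refine lintegral_mono fun z => ?_
          rw [← ENNReal.ofReal_mul (by positivity)]
          refine ENNReal.ofReal_le_ofReal ?_
          gcongr
          exact tiltVar_le_tiltSq hμ _
      _ ≤ _ := by
          have hmS : Measurable (tiltSq (mixing k d c)) :=
            measurable_integral_tilted _ (by fun_prop)
          rw [lintegral_const_mul _ (by fun_prop), ENNReal.ofReal_mul (p := 3 * C) (by positivity)]
          exact mul_le_mul' le_rfl hnull

theorem missProb_truth_le (hL : 1 ≤ L) {R : ℝ} (hR : 0 < R) :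
    missProb S d c N (fun _ i => θ₀ i) R θ₀ ≤
      ENNReal.ofReal ((q * (3 * C * ((2 + 2 * K) * L + k + k)) + n * (3 * C * b)) / R) := by
  classical
  have hμ := ae_mixing k d c
  have hQ := measurable_mahalanobisSq S
  have hmG : Measurable (tiltGap (mixing k d c)) := measurable_integral_tilted _ (by fun_prop)
  have hmS : Measurable (tiltSq (mixing k d c)) := measurable_integral_tilted _ (by fun_prop)
  have hmM : Measurable (tiltMean (mixing k d c)) := measurable_integral_tilted _ measurable_id
  -- The splitting depends on the truth: around `0` the moment of `v` itself is small, while around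
  -- a non-zero mean it is `1 - v` that must be controlled.
  refine missProb_le_of_nearlyBlack hS hNm hN0
    (G := fun i x => if θ₀ i = 0 then ENNReal.ofReal (3 * C * (mahalanobisSq S x *
        tiltSq (mixing k d c) (mahalanobisSq S x / 2) +
        k * tiltMean (mixing k d c) (mahalanobisSq S x / 2)))
      else ENNReal.ofReal (3 * C * (mahalanobisSq S x *
        tiltGap (mixing k d c) (mahalanobisSq S x / 2) + mahalanobisSq S (x - θ₀ i) +
        k * tiltMean (mixing k d c) (mahalanobisSq S x / 2)))) (fun i => ?_) ?_ hθ
    (by positivity) (by positivity) ?_ ?_ hR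
  · split_ifs <;> fun_prop
  · intro X i
    obtain ⟨y, hy⟩ := sqrtCLM_surjective hS (X i)
    rw [← hy]
    split_ifs with hi
    · rw [hi, mahalanobisSq_sqrtCLM hS]
      exact lintegral_bayes_le_tiltSq hS hNm hC0 hC y
    · obtain ⟨η, hη⟩ := sqrtCLM_surjective hS (θ₀ i)
      rw [← hη, ← map_sub, mahalanobisSq_sqrtCLM hS, mahalanobisSq_sqrtCLM hS]
      exact lintegral_bayes_sub_le hS hNm hC0 hC y η
  · intro i hi
    obtain ⟨η, hη⟩ := sqrtCLM_surjective hS (θ₀ i)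
    simp_rw [if_neg hi, ← hη, add_sub_cancel_left, ← map_add, mahalanobisSq_sqrtCLM hS]
    calc _ ≤ ∫⁻ z, ENNReal.ofReal (3 * C) * (ENNReal.ofReal ((2 + 2 * K) * L + k) +
            ENNReal.ofReal (‖z‖ ^ 2)) ∂(stdGaussian (EuclideanSpace ℝ (Fin k))) := by
          refine lintegral_mono fun z => ?_
          have h0 := norm_sq_mul_tiltGap_le hμ hgap hK hL (η + z)
          have h1 := tiltMean_le_one hμ (‖η + z‖ ^ 2 / 2)
          rw [← ENNReal.ofReal_add (by positivity) (by positivity),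
            ← ENNReal.ofReal_mul (by positivity)]
          refine ENNReal.ofReal_le_ofReal ?_
          have h2 : (k : ℝ) * tiltMean (mixing k d c) (‖η + z‖ ^ 2 / 2) ≤ k :=
            mul_le_of_le_one_right (Nat.cast_nonneg k) h1
          refine mul_le_mul_of_nonneg_left ?_ (by positivity)
          linarith
      _ = _ := by
          rw [lintegral_const_mul _ (by fun_prop), lintegral_add_left measurable_const,
            lintegral_const, measure_univ, mul_one, lintegral_norm_sq_stdGaussian,
            finrank_euclideanSpace_fin, ← ENNReal.ofReal_add (by positivity) (by positivity),
            ← ENNReal.ofReal_mul (by positivity)]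
  · intro i hi
    simp_rw [if_pos hi, mahalanobisSq_sqrtCLM hS]
    simp_rw [ENNReal.ofReal_mul (p := 3 * C) (by positivity : 0 ≤ 3 * C)]
    rw [lintegral_const_mul _ (by fun_prop)]
    gcongr

end Uniform

/-! ### Asymptotics -/

section Asymptotics

theorem scale_eq_exp {d q : ℝ} {n : ℕ} (hq : 0 < q) (hn : 0 < n) :
    scale d q n = Real.exp (-(Real.log (n / q) * (1 + 1 / Real.log (Real.log (n / q))) / d)) := by
  have hn0 : (0 : ℝ) < n := Nat.cast_pos.2 hn
  rw [scale, Real.rpow_def_of_pos (by positivity), ← inv_div (n : ℝ) q, Real.log_inv]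
  congr 1
  ring

theorem natCast_mul_exp_neg_log {q : ℝ} {n : ℕ} (hq : 0 < q) (hn : 0 < n) :
    n * Real.exp (-Real.log (n / q)) = q := by
  have hn0 : (0 : ℝ) < n := Nat.cast_pos.2 hn
  rw [Real.exp_neg, Real.exp_log (by positivity), inv_div]
  field_simp

/-- The exponent `1 / d` in `scale` makes `c ^ d` the sparsity ratio `q / n`, and `ε_n` buys the
extra factor `exp (-L / log L)`, which tends to `0`. -/
theorem scale_rpow {d q : ℝ} {n : ℕ} (hd : 0 < d) (hq : 0 < q) (hn : 0 < n) :
    scale d q n ^ d = Real.exp (-Real.log (n / q)) *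
      Real.exp (-(Real.log (n / q) / Real.log (Real.log (n / q)))) := by
  rw [scale_eq_exp hq hn, ← Real.exp_mul, ← Real.exp_add]
  congr 1
  field_simp
  ring

/-- Contribution of the zero means to the posterior spread, in units of `q`, as a function of
`L = log (n / q)`. -/
noncomputable def nullRate (k : ℕ) (d L : ℝ) : ℝ :=
  (4 * L + k) * (shrinkConst d * Real.exp (-(L / Real.log L)) / (√(1 / 2) ^ k / 2)) +
    tailConst k * Real.exp (-(1 / 2) * L)

theorem nullRate_nonneg (k : ℕ) {d L : ℝ} (hd : 0 < d) (hd1 : d < 1) (hL : 0 ≤ L) :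
    0 ≤ nullRate k d L := by
  have := shrinkConst_pos hd hd1
  have := tailConst_nonneg k
  unfold nullRate
  positivity

theorem lintegral_null_scale_le {k n : ℕ} {d q : ℝ} (hd : 0 < d) (hd1 : d < 1) (hq : 0 < q)
    (hn : 0 < n) (hL : 0 ≤ Real.log (n / q)) (hsmall : shrinkConst d * scale d q n ^ d ≤ 1 / 4) :
    ∫⁻ z, ENNReal.ofReal (‖z‖ ^ 2 * tiltSq (mixing k d (scale d q n)) (‖z‖ ^ 2 / 2) +
        k * tiltMean (mixing k d (scale d q n)) (‖z‖ ^ 2 / 2))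
        ∂(stdGaussian (EuclideanSpace ℝ (Fin k))) ≤
      ENNReal.ofReal (Real.exp (-Real.log (n / q)) * nullRate k d (Real.log (n / q))) := by
  have hc : 0 < scale d q n := by rw [scale_eq_exp hq hn]; exact Real.exp_pos _
  have hprob := isProbabilityMeasure_hyperPrior hd hc
  have hs := shrinkConst_pos hd hd1
  have he := lintegral_shrink_le hd hd1 hc
  refine (lintegral_null_le (by positivity) hL (by positivity) (mixing_univ_ge he hsmall)
    he).trans_eq ?_
  rw [scale_rpow hd hq hn, nullRate]
  set L := Real.log (n / q)
  have h1 : Real.exp (-(3 / 2) * L) = Real.exp (-L) * Real.exp (-(1 / 2) * L) := by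
    rw [← Real.exp_add]
    congr 1
    ring
  rw [h1]
  congr 1
  ring

theorem tendsto_div_log_atTop : Tendsto (fun L : ℝ => L / Real.log L) atTop atTop := by
  have h := Real.isLittleO_log_id_atTop.tendsto_div_nhds_zero
  have h2 : Tendsto (fun L : ℝ => Real.log L / L) atTop (𝓝[>] 0) := by
    refine tendsto_nhdsWithin_iff.2 ⟨h, ?_⟩
    filter_upwards [eventually_gt_atTop 1] with L hL
    exact div_pos (Real.log_pos hL) (by linarith)
  refine h2.inv_tendsto_nhdsGT_zero.congr fun L => ?_
  simp

/-- Division by `L` cancels the truncation level `4 L`, so `L / log L → ∞` is enough. -/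
theorem tendsto_nullRate_div (k : ℕ) (d : ℝ) :
    Tendsto (fun L => nullRate k d L / L) atTop (𝓝 0) := by
  have h1 : Tendsto (fun L : ℝ => Real.exp (-(L / Real.log L))) atTop (𝓝 0) :=
    Real.tendsto_exp_neg_atTop_nhds_zero.comp tendsto_div_log_atTop
  have h2 : Tendsto (fun L : ℝ => L⁻¹) atTop (𝓝 0) := tendsto_inv_atTop_zero
  have h3 : Tendsto (fun L : ℝ => Real.exp (-(1 / 2) * L)) atTop (𝓝 0) := by
    refine Real.tendsto_exp_atBot.comp ?_
    exact tendsto_id.const_mul_atTop_of_neg (by norm_num)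
  have h4 : Tendsto (fun L : ℝ => (4 + k * L⁻¹) *
      (shrinkConst d * Real.exp (-(L / Real.log L)) / (√(1 / 2) ^ k / 2)) +
      tailConst k * Real.exp (-(1 / 2) * L) * L⁻¹) atTop (𝓝 ((4 + k * 0) *
      (shrinkConst d * 0 / (√(1 / 2) ^ k / 2)) + tailConst k * 0 * 0)) :=
    ((tendsto_const_nhds.add (h2.const_mul _)).mul ((h1.const_mul _).div_const _)).add
      ((h3.const_mul _).mul h2)
  simp only [mul_zero, zero_div, add_zero] at h4
  refine h4.congr' ?_
  filter_upwards [eventually_gt_atTop 0] with L hL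
  rw [nullRate]
  field_simp

/-- With `r = L ^ α`, the terms `r / L` and `L / r²` both vanish exactly when `1 / 2 < α < 1`; here
`α = 3 / 4`. -/
theorem tendsto_nonnull_div (k : ℕ) (K : ℝ) :
    Tendsto (fun L : ℝ => (k * L ^ (3 / 4 : ℝ) +
      K * (1 + 2 * L ^ 2 / (L ^ (3 / 4 : ℝ)) ^ 2) + k) / L) atTop (𝓝 0) := by
  have h2 : Tendsto (fun L : ℝ => L⁻¹) atTop (𝓝 0) := tendsto_inv_atTop_zero
  have h3 : Tendsto (fun L : ℝ => L ^ (-(1 / 4) : ℝ)) atTop (𝓝 0) :=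
    tendsto_rpow_neg_atTop (by norm_num)
  have h4 : Tendsto (fun L : ℝ => L ^ (-(1 / 2) : ℝ)) atTop (𝓝 0) :=
    tendsto_rpow_neg_atTop (by norm_num)
  have h5 : Tendsto (fun L : ℝ => k * L ^ (-(1 / 4) : ℝ) +
      K * (L⁻¹ + 2 * L ^ (-(1 / 2) : ℝ)) + k * L⁻¹) atTop
      (𝓝 (k * 0 + K * (0 + 2 * 0) + k * 0)) :=
    ((h3.const_mul _).add ((h2.add (h4.const_mul _)).const_mul _)).add (h2.const_mul _)
  simp only [mul_zero, add_zero] at h5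
  refine h5.congr' ?_
  filter_upwards [eventually_gt_atTop 0] with L hL
  have e1 : L ^ (-(1 / 4) : ℝ) = L ^ (3 / 4 : ℝ) / L := by
    rw [show (-(1 / 4) : ℝ) = 3 / 4 - 1 by norm_num, Real.rpow_sub_one hL.ne']
  have e2 : L ^ (-(1 / 2) : ℝ) = L / (L ^ (3 / 4 : ℝ)) ^ 2 := by
    rw [← Real.rpow_natCast (L ^ (3 / 4 : ℝ)), ← Real.rpow_mul hL.le,
      show (-(1 / 2) : ℝ) = 1 - 3 / 4 * (2 : ℕ) by norm_num, Real.rpow_sub hL, Real.rpow_one]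
  have h6 : 0 < L ^ (3 / 4 : ℝ) := by positivity
  rw [e1, e2]
  field_simp

theorem tendsto_log_ratio {q : ℕ → ℝ} (hq : ∀ᶠ n in atTop, 0 < q n)
    (hqn : Asymptotics.IsLittleO atTop q (fun n : ℕ => (n : ℝ))) :
    Tendsto (fun n : ℕ => Real.log (n / q n)) atTop atTop := by
  refine Real.tendsto_log_atTop.comp ?_
  have h2 : Tendsto (fun n : ℕ => q n / n) atTop (𝓝[>] 0) := by
    refine tendsto_nhdsWithin_iff.2 ⟨hqn.tendsto_div_nhds_zero, ?_⟩
    filter_upwards [hq, eventually_gt_atTop 0] with n h1 hn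
    exact div_pos h1 (Nat.cast_pos.2 hn)
  refine h2.inv_tendsto_nhdsGT_zero.congr fun n => ?_
  simp

theorem eventually_scale_bounds {d : ℝ} (hd : 0 < d) {q : ℕ → ℝ} (hq : ∀ᶠ n in atTop, 0 < q n)
    (hqn : Asymptotics.IsLittleO atTop q (fun n : ℕ => (n : ℝ))) :
    ∀ᶠ n : ℕ in atTop, 0 < q n ∧ 0 < n ∧ 4 ≤ Real.log (n / q n) ∧
      0 < scale d (q n) n ∧ scale d (q n) n ≤ 1 ∧
      -(d * Real.log (scale d (q n) n)) ≤ 2 * Real.log (n / q n) ∧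
      shrinkConst d * scale d (q n) n ^ d ≤ 1 / 4 := by
  have hL := tendsto_log_ratio hq hqn
  have h1 : Tendsto (fun L : ℝ => shrinkConst d *
      (Real.exp (-L) * Real.exp (-(L / Real.log L)))) atTop (𝓝 (shrinkConst d * (0 * 0))) :=
    (Real.tendsto_exp_neg_atTop_nhds_zero.mul
      (Real.tendsto_exp_neg_atTop_nhds_zero.comp tendsto_div_log_atTop)).const_mul _
  simp only [mul_zero] at h1
  have h2 := (h1.comp hL).eventually (eventually_le_nhds (by norm_num : (0 : ℝ) < 1 / 4))
  -- `L ≥ e` gives `log L ≥ 1`, so `ε_n ≤ 1` and `-d log c = L (1 + ε_n) ≤ 2 L`. `L ≥ 4` serves `L ^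
  -- (3 / 4) ≥ 2`.
  filter_upwards [hq, eventually_gt_atTop 0, hL.eventually_ge_atTop 4, h2,
    hL.eventually_ge_atTop (Real.exp 1)] with n hqn hn hL4 hs he
  have hL0 : 0 < Real.log (n / q n) := by linarith
  have hll : 1 ≤ Real.log (Real.log (n / q n)) := (Real.le_log_iff_exp_le hL0).2 he
  refine ⟨hqn, hn, hL4, ?_, ?_, ?_, ?_⟩
  · rw [scale_eq_exp hqn hn]
    exact Real.exp_pos _
  · rw [scale_eq_exp hqn hn, Real.exp_le_one_iff, neg_nonpos]
    positivity
  · rw [scale_eq_exp hqn hn, Real.log_exp, mul_neg, neg_neg, mul_div_cancel₀ _ hd.ne', mul_comm]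
    gcongr
    have : 1 / Real.log (Real.log (n / q n)) ≤ 1 := by
      rw [div_le_one (by linarith)]
      exact hll
    linarith
  · rw [scale_rpow hd hqn hn]
    exact hs

theorem exists_norm_bound {k : ℕ} {S : Matrix (Fin k) (Fin k) ℝ} (hS : S.PosDef)
    {N : EuclideanSpace ℝ (Fin k) → ℝ} (hN : N = mahalanobisSq S ∨ N = euclideanSq) :
    Measurable N ∧ (∀ x, 0 ≤ N x) ∧ ∃ C, 0 ≤ C ∧ ∀ z, N (sqrtCLM S z) ≤ C * ‖z‖ ^ 2 := by
  rcases hN with rfl | rfl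
  · refine ⟨measurable_mahalanobisSq S, fun x => ?_, 1, zero_le_one, fun z => ?_⟩
    · obtain ⟨y, rfl⟩ := sqrtCLM_surjective hS x
      rw [mahalanobisSq_sqrtCLM hS]
      positivity
    · rw [mahalanobisSq_sqrtCLM hS, one_mul]
  · refine ⟨?_, fun x => sq_nonneg _, ‖sqrtCLM S‖ ^ 2, sq_nonneg _, fun z => ?_⟩
    · unfold euclideanSq
      fun_prop
    · rw [euclideanSq, ← mul_pow]
      gcongr
      exact (sqrtCLM S).le_opNorm z

end Asymptotics

end EIG

/-! ### Passage to the limit in the uniform bounds -/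

theorem theorem5 {k : ℕ} (S : Matrix (Fin k) (Fin k) ℝ) (hS : S.PosDef)
    (d : ℝ) (hd0 : 0 < d) (hd1 : d < 1)
    (q : ℕ → ℝ) (hq : ∀ᶠ n in atTop, 0 < q n)
    (hqn : Asymptotics.IsLittleO atTop q (fun n : ℕ => (n : ℝ)))
    (N : EuclideanSpace ℝ (Fin k) → ℝ)
    (hN : N = EIG.mahalanobisSq S ∨ N = EIG.euclideanSq) :
    Tendsto (fun n : ℕ => ⨆ θ₀ ∈ EIG.nearlyBlack k n (q n),
        EIG.missProb S d (EIG.scale d (q n) n) N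
          (fun X i => EIG.estimator S d (EIG.scale d (q n) n) (X i))
          (q n * Real.log (n / q n)) θ₀)
      atTop (𝓝 0) ∧
    ∀ M : ℕ → ℝ, Tendsto M atTop atTop →
      limsup (fun n : ℕ => ⨆ θ₀ ∈ EIG.nearlyBlack k n (q n),
        EIG.missProb S d (EIG.scale d (q n) n) N
          (fun _ i => θ₀ i)
          (M n * q n * Real.log (n / q n)) θ₀)
      atTop = 0 := by
  obtain ⟨hNm, hN0, C, hC0, hC⟩ := EIG.exists_norm_bound hS hN
  have hL := EIG.tendsto_log_ratio hq hqn
  have hev := EIG.eventually_scale_bounds hd0 hq hqn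
  have hK := EIG.gapConst_nonneg k d
  set K := EIG.gapConst k d
  have hnull := EIG.tendsto_nullRate_div k d
  refine ⟨?_, fun M hM => Tendsto.limsup_eq ?_⟩
  · have hlim : Tendsto (fun n : ℕ => ENNReal.ofReal (3 * C *
        ((k * Real.log (n / q n) ^ (3 / 4 : ℝ) + K * (1 + 2 * Real.log (n / q n) ^ 2 /
          (Real.log (n / q n) ^ (3 / 4 : ℝ)) ^ 2) + k) / Real.log (n / q n) +
          EIG.nullRate k d (Real.log (n / q n)) / Real.log (n / q n)))) atTop (𝓝 0) := by
      have h1 := (((EIG.tendsto_nonnull_div k K).add hnull).const_mul (3 * C)).comp hL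
      simpa using ENNReal.tendsto_ofReal h1
    refine tendsto_of_tendsto_of_tendsto_of_le_of_le' tendsto_const_nhds hlim
      (Eventually.of_forall fun _ => bot_le) ?_
    filter_upwards [hev] with n ⟨hqp, hn, hL4, hc, hc1, hcL, hsmall⟩
    have hprob := EIG.isProbabilityMeasure_hyperPrior hd0 hc
    have hnq := EIG.natCast_mul_exp_neg_log hqp hn
    set L := Real.log (n / q n)
    have hL0 : 0 < L := by linarith
    have hr : 2 ≤ L ^ (3 / 4 : ℝ) := by
      calc (2 : ℝ) ≤ 4 ^ (3 / 4 : ℝ) := by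
            rw [show (4 : ℝ) = 2 ^ (2 : ℝ) by norm_num, ← Real.rpow_mul (by norm_num)]
            calc (2 : ℝ) = 2 ^ (1 : ℝ) := (Real.rpow_one 2).symm
              _ ≤ _ := Real.rpow_le_rpow_of_exponent_le (by norm_num) (by norm_num)
        _ ≤ _ := by gcongr
    refine iSup₂_le fun θ₀ hθ => ?_
    refine (EIG.missProb_estimator_le hS hNm hN0 hC0 hC hK
      (fun s hs => EIG.tiltGap_mixing_le hd0 hd1 hc hc1 hcL hs)
      (EIG.lintegral_null_scale_le hd0 hd1 hqp hn hL0.le hsmall)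
      (mul_nonneg (Real.exp_pos _).le (EIG.nullRate_nonneg k hd0 hd1 hL0.le)) hθ hr
      (mul_pos hqp hL0)).trans_eq ?_
    congr 1
    -- As `n * exp (-L) = q`, the zero means are also measured in units of `q`, which then cancels
    -- against the radius.
    have h1 : (n : ℝ) * (3 * C * (Real.exp (-L) * EIG.nullRate k d L)) =
        q n * (3 * C * EIG.nullRate k d L) := by
      rw [← hnq]
      ring
    rw [h1, ← mul_add, mul_div_mul_left _ _ hqp.ne']
    ring
  -- Around the truth each non-zero mean costs a constant times `L`, so the bracket stays bounded
  -- and only `1 / M n` gives the decay.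
  · have hlim : Tendsto (fun n : ℕ => ENNReal.ofReal (3 * C *
        ((2 + 2 * K) + (k + k) * (Real.log (n / q n))⁻¹ +
          EIG.nullRate k d (Real.log (n / q n)) / Real.log (n / q n)) * (M n)⁻¹))
        atTop (𝓝 0) := by
      have h1 : Tendsto (fun L : ℝ => L⁻¹) atTop (𝓝 0) := tendsto_inv_atTop_zero
      have h2 := (((tendsto_const_nhds (x := 2 + 2 * K)).add
        (h1.const_mul ((k : ℝ) + k))).add hnull).comp hL
      have h3 := (h2.const_mul (3 * C)).mul (h1.comp hM)
      simpa using ENNReal.tendsto_ofReal h3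
    refine tendsto_of_tendsto_of_tendsto_of_le_of_le' tendsto_const_nhds hlim
      (Eventually.of_forall fun _ => bot_le) ?_
    filter_upwards [hev, hM.eventually_gt_atTop 0] with n
      ⟨hqp, hn, hL4, hc, hc1, hcL, hsmall⟩ hM0
    have hprob := EIG.isProbabilityMeasure_hyperPrior hd0 hc
    have hnq := EIG.natCast_mul_exp_neg_log hqp hn
    set L := Real.log (n / q n)
    have hL0 : 0 < L := by linarith
    refine iSup₂_le fun θ₀ hθ => ?_
    refine (EIG.missProb_truth_le hS hNm hN0 hC0 hC hK
      (fun s hs => EIG.tiltGap_mixing_le hd0 hd1 hc hc1 hcL hs)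
      (EIG.lintegral_null_scale_le hd0 hd1 hqp hn hL0.le hsmall)
      (mul_nonneg (Real.exp_pos _).le (EIG.nullRate_nonneg k hd0 hd1 hL0.le)) hθ (by linarith)
      (mul_pos (mul_pos hM0 hqp) hL0)).trans_eq ?_
    congr 1
    have h1 : (n : ℝ) * (3 * C * (Real.exp (-L) * EIG.nullRate k d L)) =
        q n * (3 * C * EIG.nullRate k d L) := by
      rw [← hnq]
      ring
    rw [h1]
    field_simp
    ring
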